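/- Let $R$ be a commutative artinian ring and $\Lambda$ an artin $R$-algebra (an $R$-algebra that is finitely generated as an $R$-module). All modules are finitely generated left modules. Let $D=\mathrm{Hom}_R(-,J)$ be the usual duality, where $J$ is the injective envelope of $R/\mathrm{rad}\,R$. For a class $\mathcal C$ of modules, $\mathcal F(\mathcal C)$ is the class of modules $M$ with a chain of submodules $0=M_0\subseteq M_1\subseteq\cdots\subseteq M_s=M$ all of whose factors $M_{k+1}/M_k$ are isomorphic to modules in $\mathcal C$. A proper costratifying system $(\Psi,\mathbf Q,\le)$ of size $t$ in $\mathrm{mod}(\Lambda)$ consists of $\Lambda$-modules $\Psi=\{\Psi(i)\}_{i=1}^t$, indecomposable $\Lambda$-modules $\mathbf Q=\{Q(i)\}_{i=1}^t$ and a linear order $\le$ on $\{1,\dots,t\}$ such that (i) $\mathrm{End}_\Lambda(\Psi(i))$ is a division ring for all $i$; (ii) $\mathrm{Hom}_\Lambda(\Psi(i),\Psi(j))=0$ if $i<j$; (iii) for each $i$ there is an exact sequence $0\to Z(i)\to Q(i)\to\Psi(i)\to 0$ with $Z(i)\in\mathcal F(\{\Psi(j):j\le i\})$; (iv) $\mathrm{Ext}^1_\Lambda(Q(i),\Psi(j))=0$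 for all $i,j$. Let $(\Psi,\mathbf Q,\le)$ be such a system, and put $Q=\bigoplus_{i=1}^tQ(i)$, $\Gamma=\mathrm{End}_\Lambda(Q)^{op}$, $F=\mathrm{Hom}_\Lambda(Q,-):\mathrm{mod}(\Lambda)\to\mathrm{mod}(\Gamma)$ and $T=F(D(\Lambda_\Lambda))$. Let ${}_\Gamma\overline\Delta=\{{}_\Gamma\overline\Delta(i)\}_{i=1}^t$ be the proper standard $\Gamma$-modules for the projectives ${}_\Gamma P(i)=F(Q(i))$ and the opposite order $\le^{op}$, that is, ${}_\Gamma\overline\Delta(i)={}_\Gamma P(i)/\mathrm{Tr}_{\bigoplus_{j\le i}{}_\Gamma P(j)}(\mathrm{rad}\,{}_\Gamma P(i))$, where $\mathrm{Tr}_M(N)$ is the submodule of $N$ generated by the images of all morphisms $M\to N$. Suppose that $D(\Lambda_\Lambda)\in\mathcal F(\Psi)$ and that $t$ is the rank of the Grothendieck group $K_0(\Lambda)$ of $\mathrm{mod}(\Lambda)$. Then the following hold. (a) $T$ is a (generalized) cotilting $\Gamma$-module: $T$ has finite injective dimension, $\mathrm{Ext}^n_\Gamma(T,T)=0$ for all $n>0$,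 and there is an exact sequence $0\to T_m\to\cdots\to T_1\to T_0\to D(\Gamma_\Gamma)\to 0$ with all $T_k\in\mathrm{add}(T)$, where $\mathrm{add}(T)$ is the class of finite direct sums of direct summands of $T$. (b) $\mathcal F({}_\Gamma\overline\Delta)={}^\perp T$ and $\mathcal F({}_\Gamma\overline\Delta)\cap\mathcal F({}_\Gamma\overline\Delta)^{\perp_1}=\mathrm{add}(T)$, where ${}^\perp T=\{M:\mathrm{Ext}^n_\Gamma(M,T)=0\text{ for all }n>0\}$ and $\mathcal X^{\perp_1}=\{N:\mathrm{Ext}^1_\Gamma(M,N)=0\text{ for all }M\in\mathcal X\}$. -/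

import Mathlib

open CategoryTheory CategoryTheory.Abelian
open scoped DirectSum

universe u

section Modules

variable {A : Type u} [Ring A]

/-- `𝓕(C)`: the finitely generated modules `M` having a chain of submodules
`0 = M₀ ⊆ M₁ ⊆ ⋯ ⊆ Mₛ = M` such that every factor `M_{k+1}/M_k` is isomorphic to a module in `C`. -/
def Filtered (C : ObjectProperty (ModuleCat.{u} A)) : ObjectProperty (ModuleCat.{u} A) := fun M =>
  Module.Finite A M ∧
  ∃ (s : ℕ) (F : ℕ → Submodule A M), F 0 = ⊥ ∧ F s = ⊤ ∧
    ∀ k < s, F k ≤ F (k + 1) ∧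
      ∃ X : ModuleCat.{u} A, C X ∧
        Nonempty ((F (k + 1) ⧸ (F k).submoduleOf (F (k + 1))) ≃ₗ[A] X)

/-- `⊥T`: the finitely generated `M` with `Extⁿ(M, T) = 0` for all `n > 0`. -/
def leftPerp (T : ModuleCat.{u} A) : ObjectProperty (ModuleCat.{u} A) := fun M =>
  Module.Finite A M ∧ ∀ n : ℕ, 0 < n → Subsingleton (Ext M T n)

/-- `C^{⊥₁}`: the finitely generated `N` with `Ext¹(M, N) = 0` for all `M` in `C`. -/
def rightPerpOne (C : ObjectProperty (ModuleCat.{u} A)) : ObjectProperty (ModuleCat.{u} A) :=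
  fun N => Module.Finite A N ∧ ∀ M : ModuleCat.{u} A, C M → Subsingleton (Ext M N 1)

/-- `X` is (isomorphic to) a direct summand of `M`. -/
def IsSummandOf (X M : ModuleCat.{u} A) : Prop :=
  ∃ Y : ModuleCat.{u} A, Nonempty ((X × Y) ≃ₗ[A] M)

/-- `add(M)`: the finite direct sums of direct summands of `M`. -/
def AddClosure (M : ModuleCat.{u} A) : ObjectProperty (ModuleCat.{u} A) := fun X =>
  ∃ (n : ℕ) (Y : Fin n → ModuleCat.{u} A),
    (∀ k, IsSummandOf (Y k) M) ∧ Nonempty (X ≃ₗ[A] ⨁ k, Y k)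

/-- The trace `Tr_M(N)`: the submodule of `N` generated by the images of all maps `M → N`. -/
def traceSubmodule (M N : Type u) [AddCommGroup M] [Module A M] [AddCommGroup N] [Module A N] :
    Submodule A N :=
  ⨆ f : M →ₗ[A] N, LinearMap.range f

/-- The proper standard module
`Δ̄(i) = P(i) / Tr_{⨁_{j ≥ i} P(j)} (rad P(i))` of a linearly ordered family `P`. -/
noncomputable def properStandard {κ : Type} [LinearOrder κ] (P : κ → ModuleCat.{u} A) (i : κ) :
    ModuleCat.{u} A :=
  ModuleCat.of A (P i ⧸
    (traceSubmodule (A := A) (⨁ j : {j : κ // i ≤ j}, P j) (Module.jacobson A (P i))).map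
      (Module.jacobson A (P i)).subtype)

/-- The class consisting of the members of a family of modules. -/
def familyClass {κ : Type} (X : κ → ModuleCat.{u} A) : ObjectProperty (ModuleCat.{u} A) :=
  fun M => ∃ i, M = X i

/-- `X` has a finite resolution `0 → C_m → ⋯ → C₁ → C₀ → X → 0` (exact) with all terms in the
class `C`, built by splicing short exact sequences. -/
inductive HasFiniteResolution (C : ObjectProperty (ModuleCat.{u} A)) : ModuleCat.{u} A → Prop
  | of_mem (X : ModuleCat.{u} A) (hX : C X) : HasFiniteResolution C X
  | step (K C₀ X : ModuleCat.{u} A) (f : K →ₗ[A] C₀) (g : C₀ →ₗ[A] X)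
      (hf : Function.Injective f) (hfg : Function.Exact f g) (hg : Function.Surjective g)
      (hC₀ : C C₀) (hK : HasFiniteResolution C K) : HasFiniteResolution C X

end Modules

section Duality

/-- `J` is an injective envelope of the `R`-module `M`. -/
def IsInjectiveEnvelope (R : Type u) [CommRing R] (M J : Type u) [AddCommGroup M] [Module R M]
    [AddCommGroup J] [Module R J] : Prop :=
  Module.Injective R J ∧ ∃ e : M →ₗ[R] J, Function.Injective e ∧
    ∀ N : Submodule R J, N ≠ ⊥ → N ⊓ LinearMap.range e ≠ ⊥

variable (R : Type u) [CommRing R] (J : Type u) [AddCommGroup J] [Module R J]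
  (A : Type u) [Ring A] [Algebra R A]

/-- The underlying group `Hom_R(A, J)` of the dual `D(A_A)` of the right regular module. -/
def RegularDual : Type u := A →ₗ[R] J

noncomputable instance : AddCommGroup (RegularDual R J A) :=
  inferInstanceAs (AddCommGroup (A →ₗ[R] J))

/-- The left `A`-module structure on `D(A_A)`: `(a • f)(x) = f (x * a)`. -/
noncomputable instance : Module A (RegularDual R J A) where
  smul a f := LinearMap.comp (show A →ₗ[R] J from f) (LinearMap.mulRight R a)
  one_smul f := LinearMap.ext fun x => congrArg (show A →ₗ[R] J from f) (mul_one x)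
  mul_smul a b f := LinearMap.ext fun x =>
    congrArg (show A →ₗ[R] J from f) (mul_assoc x a b).symm
  smul_zero _ := LinearMap.ext fun _ => rfl
  smul_add _ _ _ := LinearMap.ext fun _ => rfl
  add_smul a b f := LinearMap.ext fun x =>
    (congrArg (show A →ₗ[R] J from f) (mul_add x a b)).trans (map_add (show A →ₗ[R] J from f) _ _)
  zero_smul f := LinearMap.ext fun x =>
    (congrArg (show A →ₗ[R] J from f) (mul_zero x)).trans (map_zero (show A →ₗ[R] J from f))

/-- `D(A_A) = Hom_R(A, J)` as a left `A`-module. -/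
noncomputable def dualRegular : ModuleCat.{u} A := ModuleCat.of A (RegularDual R J A)

/-- `T` is a (generalized) cotilting `A`-module: it is finitely generated of finite injective
dimension, `Extⁿ(T, T) = 0` for all `n > 0`, and `D(A_A)` has a finite resolution by modules in
`add(T)`. -/
structure IsCotilting (T : ModuleCat.{u} A) : Prop where
  finite : Module.Finite A T
  finite_injectiveDimension : ∃ n : ℕ, HasInjectiveDimensionLE T n
  ext_self : ∀ n : ℕ, 0 < n → Subsingleton (Ext T T n)
  resolution : HasFiniteResolution (AddClosure T) (dualRegular R J A)

end Duality

section GrothendieckGroup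

variable (A : Type u) [Ring A]

/-- The finitely generated left `A`-modules. -/
abbrev FGMod : Type (u + 1) := {M : ModuleCat.{u} A // Module.Finite A M}

/-- The relations `[Y] = [X] + [Z]`, one for each exact sequence `0 → X → Y → Z → 0`. -/
def grothendieckRelations : AddSubgroup (FreeAbelianGroup (FGMod A)) :=
  AddSubgroup.closure {x | ∃ (X Y Z : FGMod A) (f : X.1 →ₗ[A] Y.1) (g : Y.1 →ₗ[A] Z.1),
    Function.Injective f ∧ Function.Exact f g ∧ Function.Surjective g ∧
    x = FreeAbelianGroup.of Y - (FreeAbelianGroup.of X + FreeAbelianGroup.of Z)}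

/-- The Grothendieck group `K₀(A)` of the category of finitely generated left `A`-modules. -/
abbrev GrothendieckGroup : Type (u + 1) := FreeAbelianGroup (FGMod A) ⧸ grothendieckRelations A

end GrothendieckGroup

section Endomorphisms

variable {Λ : Type u} [Ring Λ]

/-- The `R`-algebra structure of `End_Λ(X)ᵒᵖ`, where `r : R` acts as multiplication by `r`. -/
noncomputable instance endOpAlgebra (R : Type u) [CommRing R] [Algebra R Λ] (X : ModuleCat.{u} Λ) :
    Algebra R (End X)ᵐᵒᵖ :=
  RingHom.toAlgebra'
    { toFun := fun r => MulOpposite.op (End.of (ModuleCat.ofHom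
        { toFun := fun x : X => algebraMap R Λ r • x
          map_add' := fun x y => smul_add _ x y
          map_smul' := fun a x => by
            simp only [RingHom.id_apply, ← mul_smul, Algebra.commutes] }))
      map_one' := by
        apply MulOpposite.unop_injective
        refine ModuleCat.hom_ext (LinearMap.ext fun x => ?_)
        simp [End.of]
      map_mul' := fun r s => by
        apply MulOpposite.unop_injective
        refine ModuleCat.hom_ext (LinearMap.ext fun x => ?_)
        simp [End.of, mul_comm r s, mul_smul, map_mul (algebraMap R Λ) s r, -map_mul]
      map_zero' := by
        apply MulOpposite.unop_injective
        refine ModuleCat.hom_ext (LinearMap.ext fun x => ?_)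
        simp [End.of]
      map_add' := fun r s => by
        apply MulOpposite.unop_injective
        refine ModuleCat.hom_ext (LinearMap.ext fun x => ?_)
        simp only [map_add, add_smul]
        rfl }
    (fun r f => by
      apply MulOpposite.unop_injective
      refine ModuleCat.hom_ext (LinearMap.ext fun x => ?_)
      simp [End.of])

end Endomorphisms

/-- A proper costratifying system `(Ψ, Q, ≤)` in `mod Λ`, indexed by a linearly ordered type `ι`. -/
structure ProperCostratifyingSystem (Λ : Type u) [Ring Λ] (ι : Type) [LinearOrder ι] where
  Ψ : ι → ModuleCat.{u} Λ
  Q : ι → ModuleCat.{u} Λ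
  finite_Ψ : ∀ i, Module.Finite Λ (Ψ i)
  finite_Q : ∀ i, Module.Finite Λ (Q i)
  indecomposable_Q : ∀ i, Indecomposable (Q i)
  /-- `End_Λ(Ψ(i))` is a division ring. -/
  division_Ψ : ∀ i, Nontrivial (End (Ψ i)) ∧ ∀ f : End (Ψ i), f ≠ 0 → IsUnit f
  hom_Ψ : ∀ i j, i < j → ∀ f : Ψ i ⟶ Ψ j, f = 0
  exact_Q : ∀ i, ∃ (Z : ModuleCat.{u} Λ) (α : Z →ₗ[Λ] Q i) (β : Q i →ₗ[Λ] Ψ i),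
    Function.Injective α ∧ Function.Exact α β ∧ Function.Surjective β ∧
    Filtered (fun M => ∃ j ≤ i, M = Ψ j) Z
  ext_Q : ∀ i j, Subsingleton (Ext (Q i) (Ψ j) 1)

namespace ProperCostratifyingSystem

variable {Λ : Type u} [Ring Λ] {ι : Type} [LinearOrder ι] (S : ProperCostratifyingSystem Λ ι)

/-- The module `Q = ⨁ᵢ Q(i)`. -/
noncomputable def sumQ : ModuleCat.{u} Λ := ModuleCat.of Λ (⨁ i, S.Q i)

/-- The ring `Γ = End_Λ(Q)ᵒᵖ`. -/
abbrev Γ : Type u := (End S.sumQ)ᵐᵒᵖ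

/-- The functor `F = Hom_Λ(Q, -)` from `Λ`-modules to `Γ`-modules. -/
noncomputable abbrev F : ModuleCat.{u} Λ ⥤ ModuleCat.{u} S.Γ := preadditiveCoyonedaObj S.sumQ

/-- The proper standard `Γ`-modules of the pair `({F(Q(i))}, ≤ᵒᵖ)`. -/
noncomputable def properStandardΓ : ιᵒᵈ → ModuleCat.{u} S.Γ :=
  properStandard fun i : ιᵒᵈ => S.F.obj (S.Q (OrderDual.ofDual i))

end ProperCostratifyingSystem

/-! Let `C` be the class of `Γ`-modules filtered by the modules `F(Ψ(i))`. Since `Ext¹(Q(i), Ψ(j)) =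
0`, the functor `F` is exact on `Ψ`-filtered modules, and each `F(Q(i))` is projective. The kernel
of `F(Q(i)) → F(Ψ(i))` lies in the radical because `Q(i)` is indecomposable. It is generated by
images of the `F(Q(j))` with `j ≤ i`, whereas every map from such an `F(Q(j))` to the radical dies
in `F(Ψ(i))`. So `F(Ψ(i))` is the proper standard module and `C` is the class of modules filtered by
these (`exists_cover_jacobson`).

The rank hypothesis makes `T` a cogenerator of `C`. An indecomposable summand of `D(Λ)` is again
`Ψ`-filtered, so it contains some `Ψ(k)` with filtered cokernel, and its simple socle is that of
`Ψ(k)`. Every simple module is such a socle, and the simple modules span `K₀(Λ)`, of rank `t`. Hence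
all `t` indices `k` occur (`exists_injective_cosyzygy`), and every module in `C` embeds in a summand
of a power of `T` with cokernel in `C`. Moreover `F` is full on maps from filtered modules to
injective ones, which yields `Extⁿ(C, T) = 0` for `n > 0` (`ext_obj_injective`).

There is also a uniform `n` such that every finitely generated `Γ`-module has an `n`-th syzygy in
`C` (`exists_syzygyDim`). Indeed the simple top of `F(Q(j))` is a quotient of `F(Ψ(j))` by a module
whose composition factors are tops of `F(Q(k))` with `k > j` only, so a downward induction on `j`
applies.

The rest is Auslander–Buchweitz theory for the pair `(C, T)` (`IsCotiltingPair`). Dimension shifting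
bounds the injective dimension of `T`; approximations by `C` resolve `D(Γ)`; pushouts along the
cosyzygies show `⊥T ⊆ C`; and an Ext-injective object of `C` splits off a power of `T`. Fitting's
lemma finally turns summands of powers of `T` into objects of `add(T)`. -/

/-- `0 → X → Y → Z → 0` is exact. -/
structure IsShortExact {A : Type*} [Ring A] {X Y Z : Type*} [AddCommGroup X] [AddCommGroup Y]
    [AddCommGroup Z] [Module A X] [Module A Y] [Module A Z] (f : X →ₗ[A] Y) (g : Y →ₗ[A] Z) :
    Prop where
  injective : Function.Injective f
  exact : Function.Exact f g
  surjective : Function.Surjective g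

/-! ### Diagram lemmas for short exact sequences of modules -/

section ShortExactSequences

variable {A : Type*} [Ring A] {X Y Z W V : Type*} [AddCommGroup X] [AddCommGroup Y]
    [AddCommGroup Z] [AddCommGroup W] [AddCommGroup V] [Module A X] [Module A Y] [Module A Z]
    [Module A W] [Module A V]

theorem isShortExact_ker {g : Y →ₗ[A] Z} (hg : Function.Surjective g) :
    IsShortExact (LinearMap.ker g).subtype g :=
  ⟨Subtype.coe_injective, LinearMap.exact_subtype_ker_map g, hg⟩

theorem isShortExact_mkQ (N : Submodule A Y) : IsShortExact N.subtype N.mkQ :=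
  ⟨Subtype.coe_injective, LinearMap.exact_subtype_mkQ N, N.mkQ_surjective⟩

theorem isShortExact_range_mkQ {f : X →ₗ[A] Y} (hf : Function.Injective f) :
    IsShortExact f (LinearMap.range f).mkQ :=
  ⟨hf, LinearMap.exact_map_mkQ_range f, Submodule.mkQ_surjective _⟩

namespace IsShortExact

variable {f : X →ₗ[A] Y} {g : Y →ₗ[A] Z}

theorem comp_eq_zero (h : IsShortExact f g) : g ∘ₗ f = 0 :=
  LinearMap.ext fun x => h.exact.apply_apply_eq_zero x

theorem exists_desc (h : IsShortExact f g) (φ : Y →ₗ[A] W) (hφ : φ ∘ₗ f = 0) :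
    ∃ ψ : Z →ₗ[A] W, ψ ∘ₗ g = φ := by
  have hk : LinearMap.ker g ≤ LinearMap.ker φ := by
    intro y hy
    obtain ⟨x, rfl⟩ := (h.exact y).1 hy
    exact LinearMap.congr_fun hφ x
  refine ⟨(LinearMap.ker g).liftQ φ hk ∘ₗ (g.quotKerEquivOfSurjective h.surjective).symm.toLinearMap,
    LinearMap.ext fun y => ?_⟩
  have : (g.quotKerEquivOfSurjective h.surjective).symm (g y) = (LinearMap.ker g).mkQ y := by
    rw [LinearEquiv.symm_apply_eq]; rfl
  simp [this]

theorem exists_lift (h : IsShortExact f g) (φ : W →ₗ[A] Y) (hφ : g ∘ₗ φ = 0) :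
    ∃ ψ : W →ₗ[A] X, f ∘ₗ ψ = φ := by
  have hr : ∀ w, φ w ∈ LinearMap.range f := fun w =>
    (h.exact (φ w)).1 (LinearMap.congr_fun hφ w)
  refine ⟨(LinearEquiv.ofInjective f h.injective).symm.toLinearMap ∘ₗ
    φ.codRestrict (LinearMap.range f) hr, LinearMap.ext fun w => ?_⟩
  have := LinearEquiv.apply_symm_apply (LinearEquiv.ofInjective f h.injective)
    (φ.codRestrict (LinearMap.range f) hr w)
  exact congrArg Subtype.val this

theorem congr (h : IsShortExact f g) (e : W ≃ₗ[A] X) (e' : Z ≃ₗ[A] V) :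
    IsShortExact (f ∘ₗ e.toLinearMap) (e'.toLinearMap ∘ₗ g) where
  injective := h.injective.comp e.injective
  exact := fun y => by
    simp only [LinearMap.comp_apply, LinearEquiv.coe_coe, Set.mem_range, map_eq_zero_iff e' e'.injective]
    rw [h.exact y]
    exact ⟨fun ⟨x, hx⟩ => ⟨e.symm x, by simpa using hx⟩, fun ⟨w, hw⟩ => ⟨e w, hw⟩⟩
  surjective := e'.surjective.comp h.surjective

theorem congr_middle (h : IsShortExact f g) (e : Y ≃ₗ[A] W) :
    IsShortExact (e.toLinearMap ∘ₗ f) (g ∘ₗ e.symm.toLinearMap) where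
  injective := e.injective.comp h.injective
  exact := fun y => by
    have := h.exact (e.symm y)
    simp only [LinearMap.comp_apply, LinearEquiv.coe_coe, Set.mem_range] at this ⊢
    rw [this]
    exact ⟨fun ⟨x, hx⟩ => ⟨x, by simp [hx]⟩, fun ⟨w, hw⟩ => ⟨w, by simp [← hw]⟩⟩
  surjective := h.surjective.comp e.symm.surjective

theorem finite (h : IsShortExact f g) [Module.Finite A X] [Module.Finite A Z] :
    Module.Finite A Y := by
  have : Module.Finite A (LinearMap.ker g) := by
    rw [LinearMap.exact_iff.1 h.exact]
    exact Module.Finite.range f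
  have : Module.Finite A (Y ⧸ LinearMap.ker g) :=
    Module.Finite.equiv (g.quotKerEquivOfSurjective h.surjective).symm
  exact Module.Finite.of_submodule_quotient (LinearMap.ker g)

/-- If the restriction of `φ` to the first term is surjective, the kernels form an exact
sequence. -/
theorem ker_of_surjective (h : IsShortExact f g) {φ : Y →ₗ[A] W}
    (hφ : Function.Surjective (φ ∘ₗ f)) :
    IsShortExact (f.restrict (p := LinearMap.ker (φ ∘ₗ f)) (q := LinearMap.ker φ) fun _ hx => hx)
      (g ∘ₗ (LinearMap.ker φ).subtype) where
  injective := fun a b hab => Subtype.ext (h.injective (congrArg Subtype.val hab))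
  exact := by
    rintro ⟨y, hy⟩
    constructor
    · intro hy'
      obtain ⟨x, rfl⟩ := (h.exact y).1 hy'
      exact ⟨⟨x, hy⟩, rfl⟩
    · rintro ⟨⟨x, hx⟩, hxy⟩
      have : f x = y := congrArg Subtype.val hxy
      simp [← this, h.exact.apply_apply_eq_zero]
  surjective := by
    intro z
    obtain ⟨y, rfl⟩ := h.surjective z
    obtain ⟨x, hx⟩ := hφ (φ y)
    refine ⟨⟨y - f x, ?_⟩, ?_⟩
    · simpa [sub_eq_zero] using hx.symm
    · simp [h.exact.apply_apply_eq_zero]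

end IsShortExact

theorem isShortExact_inl_snd : IsShortExact (LinearMap.inl A X Y) (LinearMap.snd A X Y) :=
  ⟨LinearMap.inl_injective, Function.Exact.inl_snd, LinearMap.snd_surjective⟩

theorem isShortExact_id_zero [Subsingleton Z] :
    IsShortExact (LinearMap.id : X →ₗ[A] X) (0 : X →ₗ[A] Z) :=
  ⟨Function.injective_id, fun y => by simp, fun z => ⟨0, Subsingleton.elim _ _⟩⟩

theorem isShortExact_zero_id [Subsingleton X] :
    IsShortExact (0 : X →ₗ[A] Y) (LinearMap.id : Y →ₗ[A] Y) :=
  ⟨Function.injective_of_subsingleton _, fun y => by simp [eq_comm], Function.surjective_id⟩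

end ShortExactSequences

/-! ### Long exact sequences of `Ext`: extension, lifting and dimension shifting -/

section Ext

variable {A : Type u} [Ring A]

theorem IsShortExact.shortExact {X Y Z : ModuleCat.{u} A} {f : X →ₗ[A] Y} {g : Y →ₗ[A] Z}
    (h : IsShortExact f g) :
    (ShortComplex.moduleCatMk f g h.comp_eq_zero).ShortExact :=
  ModuleCat.shortComplex_shortExact _ h.exact h.injective h.surjective

variable {X Y Z : ModuleCat.{u} A} {f : X →ₗ[A] Y} {g : Y →ₗ[A] Z} (h : IsShortExact f g)
  {M N : ModuleCat.{u} A}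

include h

/-- Maps from the first term extend if `Ext¹` from the third one vanishes. -/
theorem IsShortExact.exists_extend (hE : Subsingleton (Ext Z N 1)) (φ : X →ₗ[A] N) :
    ∃ ψ : Y →ₗ[A] N, ψ ∘ₗ f = φ := by
  obtain ⟨x, hx⟩ := Ext.contravariant_sequence_exact₁ h.shortExact N
    (Ext.mk₀ (ModuleCat.ofHom φ : X ⟶ N)) (n₁ := 1) rfl (hE.elim _ _)
  obtain ⟨ψ, rfl⟩ := Ext.addEquiv₀.symm.surjective x
  refine ⟨ψ.hom, ?_⟩
  have : ModuleCat.ofHom f ≫ ψ = ModuleCat.ofHom φ := by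
    apply Ext.addEquiv₀.symm.injective
    exact (Ext.mk₀_comp_mk₀ _ _).symm.trans hx
  exact congrArg ModuleCat.Hom.hom this

/-- Maps to the third term lift if `Ext¹` to the first one vanishes. -/
theorem IsShortExact.exists_lift_of_ext (hE : Subsingleton (Ext M X 1)) (φ : M →ₗ[A] Z) :
    ∃ ψ : M →ₗ[A] Y, g ∘ₗ ψ = φ := by
  obtain ⟨x, hx⟩ := Ext.covariant_sequence_exact₃ M h.shortExact
    (Ext.mk₀ (ModuleCat.ofHom φ : M ⟶ Z)) (n₁ := 1) rfl (hE.elim _ _)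
  obtain ⟨ψ, rfl⟩ := Ext.addEquiv₀.symm.surjective x
  refine ⟨ψ.hom, ?_⟩
  have : ψ ≫ ModuleCat.ofHom g = ModuleCat.ofHom φ := by
    apply Ext.addEquiv₀.symm.injective
    exact (Ext.mk₀_comp_mk₀ _ _).symm.trans hx
  exact congrArg ModuleCat.Hom.hom this

theorem IsShortExact.ext_middle_left (n : ℕ) (h₁ : Subsingleton (Ext X N n))
    (h₃ : Subsingleton (Ext Z N n)) : Subsingleton (Ext Y N n) := by
  refine subsingleton_of_forall_eq 0 fun x => ?_
  obtain ⟨y, rfl⟩ := Ext.contravariant_sequence_exact₂ h.shortExact N x (h₁.elim _ _)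
  have hy : y = 0 := h₃.elim _ _
  subst hy
  exact Ext.comp_zero ..

theorem IsShortExact.ext_middle_right (n : ℕ) (h₁ : Subsingleton (Ext M X n))
    (h₃ : Subsingleton (Ext M Z n)) : Subsingleton (Ext M Y n) := by
  refine subsingleton_of_forall_eq 0 fun x => ?_
  obtain ⟨y, rfl⟩ := Ext.covariant_sequence_exact₂ M h.shortExact x (h₃.elim _ _)
  have hy : y = 0 := h₁.elim _ _
  subst hy
  exact Ext.zero_comp ..

theorem IsShortExact.ext_third_left (n : ℕ) (h₁ : Subsingleton (Ext X N n))
    (h₂ : Subsingleton (Ext Y N (n + 1))) : Subsingleton (Ext Z N (n + 1)) := by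
  refine subsingleton_of_forall_eq 0 fun x => ?_
  obtain ⟨y, rfl⟩ := Ext.contravariant_sequence_exact₃ h.shortExact N x (h₂.elim _ _)
    (add_comm 1 n)
  have hy : y = 0 := h₁.elim _ _
  subst hy
  exact Ext.comp_zero ..

theorem IsShortExact.ext_first_left (n : ℕ) (h₂ : Subsingleton (Ext Y N n))
    (h₃ : Subsingleton (Ext Z N (n + 1))) : Subsingleton (Ext X N n) := by
  refine subsingleton_of_forall_eq 0 fun x => ?_
  obtain ⟨y, rfl⟩ := Ext.contravariant_sequence_exact₁ h.shortExact N x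
    (add_comm 1 n) (h₃.elim _ _)
  have hy : y = 0 := h₂.elim _ _
  subst hy
  exact Ext.comp_zero ..

theorem IsShortExact.ext_third_right (n : ℕ) (h₁ : Subsingleton (Ext M X (n + 1)))
    (h₂ : Subsingleton (Ext M Y n)) : Subsingleton (Ext M Z n) := by
  refine subsingleton_of_forall_eq 0 fun x => ?_
  obtain ⟨y, rfl⟩ := Ext.covariant_sequence_exact₃ M h.shortExact x rfl (h₁.elim _ _)
  have hy : y = 0 := h₂.elim _ _
  subst hy
  exact Ext.zero_comp ..

/-- `Ext¹(Z, N) = 0` if `Ext¹(Y, N) = 0` and all maps `X → N` extend to `Y`. -/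
theorem IsShortExact.ext_one_of_extend (h₂ : Subsingleton (Ext Y N 1))
    (he : ∀ φ : X →ₗ[A] N, ∃ ψ : Y →ₗ[A] N, ψ ∘ₗ f = φ) : Subsingleton (Ext Z N 1) := by
  refine subsingleton_of_forall_eq 0 fun x => ?_
  obtain ⟨y, rfl⟩ := Ext.contravariant_sequence_exact₃ h.shortExact N x (h₂.elim _ _)
    (add_comm 1 0)
  obtain ⟨φ, rfl⟩ := Ext.addEquiv₀.symm.surjective y
  obtain ⟨ψ, hψ⟩ := he φ.hom
  have : (Ext.addEquiv₀.symm φ : Ext X N 0) =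
      (Ext.mk₀ (ModuleCat.ofHom f : X ⟶ Y)).comp (Ext.mk₀ (ModuleCat.ofHom ψ)) (zero_add 0) := by
    rw [Ext.mk₀_comp_mk₀]
    exact congrArg Ext.mk₀ (ModuleCat.hom_ext hψ.symm)
  change h.shortExact.extClass.comp (Ext.addEquiv₀.symm φ : Ext X N 0) _ = 0
  rw [this]
  exact h.shortExact.extClass_comp_assoc _

omit h

end Ext

/-- `X` is a retract of `M`. -/
def IsRetractOf {A : Type*} [Ring A] (X M : Type*) [AddCommGroup X] [AddCommGroup M]
    [Module A X] [Module A M] : Prop :=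
  ∃ (i : X →ₗ[A] M) (p : M →ₗ[A] X), p ∘ₗ i = LinearMap.id

section Ext

variable {A : Type u} [Ring A] {M N X : ModuleCat.{u} A}

theorem ext_subsingleton_of_retract_right {n : ℕ} (e : IsRetractOf (A := A) N X)
    (hX : Subsingleton (Ext M X n)) : Subsingleton (Ext M N n) := by
  obtain ⟨i, p, hip⟩ := e
  refine subsingleton_of_forall_eq 0 fun x => ?_
  have : x = (x.comp (Ext.mk₀ (ModuleCat.ofHom i : N ⟶ X)) (add_zero n)).comp
      (Ext.mk₀ (ModuleCat.ofHom p : X ⟶ N)) (add_zero n) := by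
    rw [Ext.comp_assoc_of_third_deg_zero, Ext.mk₀_comp_mk₀, ← ModuleCat.ofHom_comp, hip]
    simp
  rw [this, hX.elim (x.comp (Ext.mk₀ (ModuleCat.ofHom i : N ⟶ X)) (add_zero n)) 0, Ext.zero_comp]

theorem ext_subsingleton_of_projective {n : ℕ} (hn : 0 < n) (hM : Module.Projective A M) :
    Subsingleton (Ext M N n) := by
  have : Projective M := (IsProjective.iff_projective M).1 hM
  obtain ⟨n, rfl⟩ := Nat.exists_eq_succ_of_ne_zero hn.ne'
  exact Ext.subsingleton_of_projective _ _ _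

theorem ext_subsingleton_of_injective {n : ℕ} (hn : 0 < n) (hN : Module.Injective A N) :
    Subsingleton (Ext M N n) := by
  have : Injective N := (Module.injective_iff_injective_object A N).1 hN
  obtain ⟨n, rfl⟩ := Nat.exists_eq_succ_of_ne_zero hn.ne'
  exact Ext.subsingleton_of_injective _ _ _

end Ext

/-! ### Filtrations with prescribed factors -/

section Filtrations

variable {A : Type u} [Ring A]

/-- `M` has a filtration of length `n` with factors isomorphic to modules in `C`. -/
inductive HasFiltration (C : ObjectProperty (ModuleCat.{u} A)) : ℕ → ModuleCat.{u} A → Prop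
  | zero (M : ModuleCat.{u} A) (hM : Subsingleton M) : HasFiltration C 0 M
  | succ {n : ℕ} (N M X : ModuleCat.{u} A) (f : N →ₗ[A] M) (g : M →ₗ[A] X)
      (h : IsShortExact f g) (hN : HasFiltration C n N) (hX : C X) : HasFiltration C (n + 1) M

variable {C C' : ObjectProperty (ModuleCat.{u} A)} {X Y Z M N : ModuleCat.{u} A}

theorem HasFiltration.of_equiv {n : ℕ} (hM : HasFiltration C n M) (e : M ≃ₗ[A] N) :
    HasFiltration C n N := by
  cases hM with
  | zero _ h => exact .zero _ e.symm.toEquiv.subsingleton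
  | succ N' _ X f g h hN hX =>
    exact .succ N' N X _ _ (h.congr_middle e) hN hX

theorem HasFiltration.mono {n : ℕ} (hM : HasFiltration C n M)
    (hC : ∀ X, C X → ∃ Y, C' Y ∧ Nonempty (X ≃ₗ[A] Y)) : HasFiltration C' n M := by
  induction hM with
  | zero M h => exact .zero M h
  | succ N M X f g h hN hX ih =>
    obtain ⟨Y, hY, ⟨e⟩⟩ := hC X hX
    exact .succ N M Y f _ (h.congr (LinearEquiv.refl A N) e) ih hY

theorem HasFiltration.single (hX : C X) : HasFiltration C 1 X :=
  .succ (ModuleCat.of A PUnit) X X 0 LinearMap.id isShortExact_zero_id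
    (.zero _ (inferInstanceAs (Subsingleton PUnit))) hX

/-- Pulling the extension back to a submodule of `Z`, given as a kernel, makes it possible to strip
off the top factor of a filtration of `Z`. -/
theorem IsShortExact.preimage {X Y Z W : Type*} [AddCommGroup X] [AddCommGroup Y]
    [AddCommGroup Z] [AddCommGroup W] [Module A X] [Module A Y] [Module A Z] [Module A W]
    {f : X →ₗ[A] Y} {g : Y →ₗ[A] Z} (h : IsShortExact f g) (w : Z →ₗ[A] W) :
    IsShortExact (f.codRestrict (LinearMap.ker (w ∘ₗ g)) fun x => by
        simp [h.exact.apply_apply_eq_zero])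
      (g.restrict (p := LinearMap.ker (w ∘ₗ g)) (q := LinearMap.ker w) fun _ hx => hx) where
  injective := fun a b hab => h.injective (congrArg Subtype.val hab)
  exact := by
    rintro ⟨y, hy⟩
    constructor
    · intro hy'
      obtain ⟨x, hx⟩ := (h.exact y).1 (congrArg Subtype.val hy')
      exact ⟨x, Subtype.ext hx⟩
    · rintro ⟨x, hx⟩
      have : f x = y := congrArg Subtype.val hx
      exact Subtype.ext ((h.exact y).2 ⟨x, this⟩)
  surjective := by
    rintro ⟨z, hz⟩
    obtain ⟨y, rfl⟩ := h.surjective z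
    exact ⟨⟨y, hz⟩, rfl⟩

theorem IsShortExact.equiv_ker {X Y Z : Type*} [AddCommGroup X] [AddCommGroup Y]
    [AddCommGroup Z] [Module A X] [Module A Y] [Module A Z]
    {f : X →ₗ[A] Y} {g : Y →ₗ[A] Z} (h : IsShortExact f g) :
    Nonempty (X ≃ₗ[A] LinearMap.ker g) :=
  ⟨(LinearEquiv.ofInjective f h.injective).trans
    (LinearEquiv.ofEq _ _ (LinearMap.exact_iff.1 h.exact).symm)⟩

/-- Induction on the filtration of `Z`: the preimage in `Y` of its last proper term is an extension
of a shorter filtered module by `X`, and the top factor is unchanged. -/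
theorem HasFiltration.extension {n m : ℕ} (hX : HasFiltration C n X) (hZ : HasFiltration C m Z)
    {f : X →ₗ[A] Y} {g : Y →ₗ[A] Z} (h : IsShortExact f g) : HasFiltration C (n + m) Y := by
  induction hZ generalizing Y with
  | zero Z hZ =>
    obtain ⟨e⟩ := h.equiv_ker
    have hg : g = 0 := LinearMap.ext fun _ => Subsingleton.elim _ _
    exact hX.of_equiv (e.trans (LinearEquiv.ofTop _ (by rw [hg, LinearMap.ker_zero])))
  | succ N Z W a w hw hN hW ih =>
    obtain ⟨e⟩ := hw.equiv_ker
    have h1 := (h.preimage w).congr (LinearEquiv.refl A X) e.symm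
    have h2 := ih (Y := ModuleCat.of A (LinearMap.ker (w ∘ₗ g))) h1
    have hs : Function.Surjective (w ∘ₗ g) := by
      rw [LinearMap.coe_comp]
      exact hw.surjective.comp h.surjective
    exact .succ _ Y W _ (w ∘ₗ g) (isShortExact_ker hs) h2 hW

theorem HasFiltration.finite {n : ℕ} (hM : HasFiltration C n M)
    (hC : ∀ X, C X → Module.Finite A X) : Module.Finite A M := by
  induction hM with
  | zero M h => exact inferInstance
  | succ N M X f g h hN hX ih =>
    have := hC X hX
    exact h.finite

/-- The inductive form removes factors one at a time from the top and keeps track of their number,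
which the later inductions on length need. -/
theorem Filtered.hasFiltration (hM : Filtered C M) : ∃ n, HasFiltration C n M := by
  obtain ⟨_, s, F, h0, hs, hF⟩ := hM
  have key : ∀ k ≤ s, HasFiltration C k (ModuleCat.of A (F k)) := by
    intro k
    induction k with
    | zero =>
      intro _
      refine .zero _ ?_
      change Subsingleton (F 0)
      rw [h0]
      infer_instance
    | succ k ih =>
      intro hk
      obtain ⟨hle, X, hX, ⟨e⟩⟩ := hF k hk
      have h1 := isShortExact_mkQ ((F k).submoduleOf (F (k + 1)))
      exact .succ (ModuleCat.of A (F k)) _ X _ _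
        (h1.congr (Submodule.submoduleOfEquivOfLe hle).symm e) (ih (by omega)) hX
  exact ⟨s, (key s le_rfl).of_equiv (LinearEquiv.ofTop _ hs)⟩

theorem HasFiltration.filtered {n : ℕ} (hM : HasFiltration C n M)
    (hC : ∀ X, C X → Module.Finite A X) : Filtered C M := by
  refine ⟨hM.finite hC, n, ?_⟩
  induction hM with
  | zero M h => exact ⟨fun _ => ⊥, rfl, Subsingleton.elim _ _, fun k hk => by omega⟩
  | @succ n N M X f g h hN hX ih =>
    obtain ⟨F, h0, hs, hF⟩ := ih
    have hr : (F n).map f = LinearMap.ker g := by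
      rw [hs, Submodule.map_top, LinearMap.exact_iff.1 h.exact]
    obtain ⟨G, hG, hG'⟩ : ∃ G : ℕ → Submodule A M, (∀ k ≤ n, G k = (F k).map f) ∧ G (n + 1) = ⊤ :=
      ⟨fun k => if k ≤ n then (F k).map f else ⊤, fun k hk => if_pos hk, if_neg (by omega)⟩
    refine ⟨G, by simp [hG, h0], hG', fun k hk => ?_⟩
    rcases Nat.lt_or_ge k n with hkn | hkn
    · obtain ⟨hle, Y, hY, ⟨e⟩⟩ := hF k hkn
      rw [hG k hkn.le, hG (k + 1) hkn]
      refine ⟨Submodule.map_mono hle, Y, hY, ⟨(Submodule.Quotient.equiv _ _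
        ((F (k + 1)).equivMapOfInjective f h.injective) ?_).symm.trans e⟩⟩
      ext ⟨x, hx⟩
      obtain ⟨y, hy, rfl⟩ := hx
      constructor
      · rintro ⟨⟨z, hz⟩, hz1, hz2⟩
        exact ⟨z, hz1, congrArg Subtype.val hz2⟩
      · rintro ⟨z, hz1, hz2⟩
        exact ⟨⟨z, hle hz1⟩, hz1, Subtype.ext hz2⟩
    · obtain rfl : k = n := by omega
      rw [hG k le_rfl, hG']
      refine ⟨le_top, X, hX, ⟨(Submodule.quotEquivOfEq _ _ ?_).trans
        ((g ∘ₗ (⊤ : Submodule A M).subtype).quotKerEquivOfSurjective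
          (h.surjective.comp fun x => ⟨⟨x, trivial⟩, rfl⟩))⟩⟩
      rw [hr]
      rfl

theorem HasFiltration.prod {n m : ℕ} (hX : HasFiltration C n X) (hY : HasFiltration C m Y) :
    HasFiltration C (n + m) (ModuleCat.of A (X × Y)) :=
  hX.extension hY isShortExact_inl_snd

/-- Noether isomorphism: after division by the submodule `W` of `X`, the module `V = X/W` takes the
place of `X`. It serves to split off factors at the bottom of a filtration, and in the approximation
argument. -/
theorem IsShortExact.quotient_range {X Y Z W V : Type*} [AddCommGroup X] [AddCommGroup Y]
    [AddCommGroup Z] [AddCommGroup W] [AddCommGroup V] [Module A X] [Module A Y] [Module A Z]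
    [Module A W] [Module A V] {f : X →ₗ[A] Y} {g : Y →ₗ[A] Z} (h : IsShortExact f g)
    {a : W →ₗ[A] X} {b : X →ₗ[A] V} (hab : IsShortExact a b) :
    ∃ (φ : V →ₗ[A] Y ⧸ LinearMap.range (f ∘ₗ a)) (ψ : Y ⧸ LinearMap.range (f ∘ₗ a) →ₗ[A] Z),
      IsShortExact φ ψ := by
  have hinj : Function.Injective (f ∘ₗ a) := h.injective.comp hab.injective
  let q := (LinearMap.range (f ∘ₗ a)).mkQ
  obtain ⟨φ, hφ⟩ := hab.exists_desc (q ∘ₗ f) (LinearMap.ext fun x => by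
    simp only [LinearMap.comp_apply, LinearMap.zero_apply]
    exact (Submodule.Quotient.mk_eq_zero _).2 ⟨x, rfl⟩)
  obtain ⟨ψ, hψ⟩ := (isShortExact_range_mkQ hinj).exists_desc g
    (LinearMap.ext fun x => by simp [h.exact.apply_apply_eq_zero])
  have hφ' : ∀ x, φ (b x) = q (f x) := LinearMap.congr_fun hφ
  have hψ' : ∀ x, ψ (q x) = g x := LinearMap.congr_fun hψ
  refine ⟨φ, ψ, ⟨?_, ?_, ?_⟩⟩
  · refine (injective_iff_map_eq_zero φ).2 fun v hv => ?_
    obtain ⟨x, rfl⟩ := hab.surjective v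
    rw [hφ'] at hv
    obtain ⟨w, hw⟩ := (Submodule.Quotient.mk_eq_zero _).1 hv
    rw [← h.injective hw, hab.exact.apply_apply_eq_zero]
  · intro y
    obtain ⟨y, rfl⟩ := Submodule.mkQ_surjective _ y
    rw [show ψ (Submodule.mkQ _ y) = g y from hψ' y, h.exact y]
    constructor
    · rintro ⟨x, rfl⟩
      exact ⟨b x, hφ' x⟩
    · rintro ⟨v, hv⟩
      obtain ⟨x, rfl⟩ := hab.surjective v
      rw [hφ'] at hv
      obtain ⟨w, hw⟩ := (Submodule.Quotient.eq _).1 hv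
      refine ⟨x - a w, ?_⟩
      rw [map_sub, sub_eq_iff_eq_add, ← sub_eq_iff_eq_add', ← hw]
      rfl
  · intro x
    obtain ⟨y, rfl⟩ := h.surjective x
    exact ⟨q y, hψ' y⟩

/-- A nonzero filtered module contains a member of the class with filtered cokernel. -/
theorem HasFiltration.exists_sub {n : ℕ} (hM : HasFiltration C n M) (h0 : Nontrivial M) :
    ∃ (X Y : ModuleCat.{u} A) (f : X →ₗ[A] M) (g : M →ₗ[A] Y) (m : ℕ), C X ∧
      IsShortExact f g ∧ HasFiltration C m Y := by
  induction hM with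
  | zero M h => exact (not_nontrivial M h0).elim
  | succ N M X f g h hN hX ih =>
    rcases subsingleton_or_nontrivial N with hs | hs
    · have hg : Function.Bijective g := by
        refine ⟨(injective_iff_map_eq_zero g).2 fun y hy => ?_, h.surjective⟩
        obtain ⟨x, rfl⟩ := (h.exact y).1 hy
        rw [Subsingleton.elim x 0, map_zero]
      let e := LinearEquiv.ofBijective g hg
      refine ⟨X, ModuleCat.of A PUnit, e.symm.toLinearMap, 0, 0, hX, ?_,
        .zero _ (inferInstanceAs (Subsingleton PUnit))⟩
      exact (isShortExact_id_zero (A := A) (X := X) (Z := PUnit)).congr_middle e.symm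
    · obtain ⟨W, V, a, b, m, hW, hab, hV⟩ := ih hs
      obtain ⟨φ, ψ, hφ⟩ := h.quotient_range hab
      exact ⟨W, ModuleCat.of A (M ⧸ LinearMap.range (f ∘ₗ a)), f ∘ₗ a, _, m + 1, hW,
        isShortExact_range_mkQ (h.injective.comp hab.injective), .succ V _ X φ ψ hφ hV hX⟩

end Filtrations

/-! ### Modules filtered by bricks and their relative projective covers -/

section BrickSystems

variable {A : Type u} [Ring A] {ι : Type} [LinearOrder ι]

/-- The members `Ψ j`, `j ≤ i`, of a family of modules. -/
def lowerClass (Ψ : ι → ModuleCat.{u} A) (i : ι) : ObjectProperty (ModuleCat.{u} A) :=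
  fun M => ∃ j ≤ i, M = Ψ j

/-- Bricks `Ψ i` without maps from smaller to larger ones, covered by modules `Q i` that are
projective relative to the `Ψ`-filtered modules. -/
structure IsBrickSystem (Ψ Q : ι → ModuleCat.{u} A) : Prop where
  nontrivial : ∀ i, Nontrivial (Ψ i)
  bijective : ∀ i (f : Ψ i →ₗ[A] Ψ i), f ≠ 0 → Function.Bijective f
  hom_eq_zero : ∀ i j, i < j → ∀ f : Ψ i →ₗ[A] Ψ j, f = 0
  cover : ∀ i, ∃ (Z : ModuleCat.{u} A) (n : ℕ) (α : Z →ₗ[A] Q i) (β : Q i →ₗ[A] Ψ i),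
    IsShortExact α β ∧ HasFiltration (lowerClass Ψ i) n Z
  ext_cover : ∀ i j, Subsingleton (Ext (Q i) (Ψ j) 1)

variable {Ψ Q : ι → ModuleCat.{u} A} {X Y : ModuleCat.{u} A} {n : ℕ} {i j k : ι}

theorem HasFiltration.mono_lower (hX : HasFiltration (lowerClass Ψ i) n X) (h : i ≤ j) :
    HasFiltration (lowerClass Ψ j) n X :=
  hX.mono fun Y ⟨k, hk, hY⟩ => ⟨Y, ⟨k, hk.trans h, hY⟩, ⟨LinearEquiv.refl A Y⟩⟩

theorem HasFiltration.family_of_lower (hX : HasFiltration (lowerClass Ψ i) n X) :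
    HasFiltration (familyClass Ψ) n X :=
  hX.mono fun Y ⟨k, _, hY⟩ => ⟨Y, ⟨k, hY⟩, ⟨LinearEquiv.refl A Y⟩⟩

theorem ext_subsingleton_of_subsingleton_right {M N : ModuleCat.{u} A} (h : Subsingleton N)
    (n : ℕ) : Subsingleton (Ext M N n) := by
  refine subsingleton_of_forall_eq 0 fun x => ?_
  have : 𝟙 N = 0 := ModuleCat.hom_ext (LinearMap.ext fun _ => Subsingleton.elim _ _)
  rw [← Ext.comp_mk₀_id x, this, Ext.mk₀_zero, Ext.comp_zero]

theorem ext_subsingleton_of_subsingleton_left {M N : ModuleCat.{u} A} (h : Subsingleton M)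
    (n : ℕ) : Subsingleton (Ext M N n) := by
  refine subsingleton_of_forall_eq 0 fun x => ?_
  have : 𝟙 M = 0 := ModuleCat.hom_ext (LinearMap.ext fun _ => Subsingleton.elim _ _)
  rw [← Ext.mk₀_id_comp x, this, Ext.mk₀_zero, Ext.zero_comp]

theorem HasFiltration.ext_right {C : ObjectProperty (ModuleCat.{u} A)} {m : ℕ} {M : ModuleCat.{u} A}
    (hX : HasFiltration C n X) (hC : ∀ Y, C Y → Subsingleton (Ext M Y m)) :
    Subsingleton (Ext M X m) := by
  induction hX with
  | zero X h => exact ext_subsingleton_of_subsingleton_right h m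
  | succ N X Y f g h hN hY ih => exact h.ext_middle_right m ih (hC Y hY)

theorem HasFiltration.ext_left {C : ObjectProperty (ModuleCat.{u} A)} {m : ℕ} {M : ModuleCat.{u} A}
    (hX : HasFiltration C n X) (hC : ∀ Y, C Y → Subsingleton (Ext Y M m)) :
    Subsingleton (Ext X M m) := by
  induction hX with
  | zero X h => exact ext_subsingleton_of_subsingleton_left h m
  | succ N X Y f g h hN hY ih => exact h.ext_middle_left m ih (hC Y hY)

theorem HasFiltration.hom_eq_zero {C : ObjectProperty (ModuleCat.{u} A)} {M : Type*}
    [AddCommGroup M] [Module A M] (hX : HasFiltration C n X)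
    (hC : ∀ Y, C Y → ∀ f : Y →ₗ[A] M, f = 0) (f : X →ₗ[A] M) : f = 0 := by
  induction hX with
  | zero X h => exact LinearMap.ext fun x => by rw [Subsingleton.elim x 0, map_zero, map_zero]
  | succ N X Y a b h hN hY ih =>
    obtain ⟨ψ, rfl⟩ := h.exists_desc f (ih _)
    rw [hC Y hY ψ, LinearMap.zero_comp]

namespace IsBrickSystem

variable (S : IsBrickSystem Ψ Q)

include S

theorem lower_hom_eq_zero (hX : HasFiltration (lowerClass Ψ i) n X) (hij : i < j)
    (f : X →ₗ[A] Ψ j) : f = 0 :=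
  hX.hom_eq_zero (by
    rintro _ ⟨k, hk, rfl⟩ g
    exact S.hom_eq_zero k j (hk.trans_lt hij) g) f

theorem cover_filtration (i : ι) : ∃ n, HasFiltration (lowerClass Ψ i) n (Q i) := by
  obtain ⟨Z, n, α, β, h, hZ⟩ := S.cover i
  exact ⟨n + 1, .succ Z _ _ α β h hZ ⟨i, le_rfl, rfl⟩⟩

theorem cover_hom_eq_zero (hij : i < j) (f : Q i →ₗ[A] Ψ j) : f = 0 :=
  S.lower_hom_eq_zero (S.cover_filtration i).choose_spec hij f

/-- All factors of `Z(i)` have index at most `i < j`, so the only map `Z(i) → Ψ j` is zero, and it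
extends to `Q i`. -/
theorem ext_one_eq_zero (hij : i < j) : Subsingleton (Ext (Ψ i) (Ψ j) 1) := by
  obtain ⟨Z, n, α, β, h, hZ⟩ := S.cover i
  exact h.ext_one_of_extend (S.ext_cover i j) fun φ =>
    ⟨0, by rw [S.lower_hom_eq_zero hZ hij φ, LinearMap.zero_comp]⟩

theorem ext_cover_filtered (hX : HasFiltration (familyClass Ψ) n X) (i : ι) :
    Subsingleton (Ext (Q i) X 1) :=
  hX.ext_right fun _ ⟨j, hj⟩ => hj ▸ S.ext_cover i j

/-- A nonzero map from a `Ψ_{≤ i}`-filtered module to `Ψ i` is surjective with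
`Ψ_{≤ i}`-filtered kernel. -/
theorem ker_of_ne_zero (hX : HasFiltration (lowerClass Ψ i) n X) {f : X →ₗ[A] Ψ i} (hf : f ≠ 0) :
    Function.Surjective f ∧ ∃ m, n = m + 1 ∧
      HasFiltration (lowerClass Ψ i) m (ModuleCat.of A (LinearMap.ker f)) := by
  induction hX with
  | zero X h => exact (hf (LinearMap.ext fun x => by rw [Subsingleton.elim x 0, map_zero, map_zero])).elim
  | succ N X Y a b h hN hY ih =>
    by_cases hfa : f ∘ₗ a = 0
    · obtain ⟨ψ, rfl⟩ := h.exists_desc f hfa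
      obtain ⟨j, hj, rfl⟩ := hY
      have hψ : ψ ≠ 0 := fun h0 => hf (by rw [h0, LinearMap.zero_comp])
      obtain rfl | hj := hj.eq_or_lt
      · have hb := S.bijective j ψ hψ
        refine ⟨by rw [LinearMap.coe_comp]; exact hb.2.comp h.surjective, _, rfl, ?_⟩
        obtain ⟨e⟩ := h.equiv_ker
        refine hN.of_equiv (e.trans (LinearEquiv.ofEq _ _ ?_))
        rw [LinearMap.ker_comp_of_ker_eq_bot _ (LinearMap.ker_eq_bot.2 hb.1)]
      · exact (hψ (S.hom_eq_zero _ _ hj ψ)).elim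
    · obtain ⟨hs, m, rfl, hm⟩ := ih hfa
      refine ⟨fun y => ?_, _, rfl, .succ _ _ _ _ _ (h.ker_of_surjective hs) hm hY⟩
      obtain ⟨x, hx⟩ := hs y
      exact ⟨a x, hx⟩

/-- The index `k` is the largest one that occurs in the filtration. A map from a submodule to `Ψ k`
extends over a factor `Ψ m` with `m < k` because `Ext¹(Ψ m, Ψ k) = 0`. -/
theorem exists_ne_zero (hX : HasFiltration (familyClass Ψ) n X) (h0 : Nontrivial X) :
    ∃ k, HasFiltration (lowerClass Ψ k) n X ∧ ∃ f : X →ₗ[A] Ψ k, f ≠ 0 := by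
  induction hX with
  | zero M h => exact (not_nontrivial M h0).elim
  | @succ n N X Y a b h hN hY ih =>
    obtain ⟨m, rfl⟩ := hY
    have hb : b ≠ 0 := by
      rintro rfl
      obtain ⟨y, hy⟩ := @exists_ne _ (S.nontrivial m) 0
      obtain ⟨x, hx⟩ := h.surjective y
      exact hy hx.symm
    rcases subsingleton_or_nontrivial N with hs | hs
    · have hN' : HasFiltration (lowerClass Ψ m) n N := by
        cases hN with
        | zero _ h => exact .zero _ h
        | succ N' _ Y f g h' hN' hY =>
          obtain ⟨l, rfl⟩ := hY
          obtain ⟨y, hy⟩ := @exists_ne _ (S.nontrivial l) 0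
          obtain ⟨x, rfl⟩ := h'.surjective y
          exact (hy (by rw [Subsingleton.elim x 0, map_zero])).elim
      exact ⟨m, .succ _ _ _ a b h hN' ⟨m, le_rfl, rfl⟩, b, hb⟩
    · obtain ⟨k, hk, f, hf⟩ := ih hs
      rcases le_or_gt k m with hkm | hkm
      · exact ⟨m, .succ _ _ _ a b h (hk.mono_lower hkm) ⟨m, le_rfl, rfl⟩, b, hb⟩
      · obtain ⟨ψ, rfl⟩ := h.exists_extend (S.ext_one_eq_zero hkm) f
        refine ⟨k, .succ _ _ _ a b h hk ⟨m, hkm.le, rfl⟩, ψ, fun h0 => hf ?_⟩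
        rw [h0, LinearMap.zero_comp]

/-- The `Ψ`-filtered modules are closed under direct summands. -/
theorem filtration_of_prod (hX : HasFiltration (familyClass Ψ) n (ModuleCat.of A (X × Y))) :
    (∃ m, HasFiltration (familyClass Ψ) m X) ∧ ∃ m, HasFiltration (familyClass Ψ) m Y := by
  induction n using Nat.strong_induction_on generalizing X Y with
  | _ n ih =>
    -- With `k` the largest index, a map to `Ψ k` that is nonzero on `X` is first replaced by one
    -- that vanishes on `Y`. Its kernel is `ker f × Y`, filtered with one factor less, so the
    -- induction hypothesis applies to it.
    have step : ∀ {X Y : ModuleCat.{u} A} {k : ι},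
        HasFiltration (lowerClass Ψ k) n (ModuleCat.of A (X × Y)) → ∀ f : X →ₗ[A] Ψ k, f ≠ 0 →
        (∃ m, HasFiltration (familyClass Ψ) m X) ∧ ∃ m, HasFiltration (familyClass Ψ) m Y := by
      intro X Y k hk f hf
      have hf' : (f ∘ₗ LinearMap.fst A X Y) ≠ 0 := fun h0 => hf <| LinearMap.ext fun x =>
        LinearMap.congr_fun h0 (x, 0)
      obtain ⟨hs, m, rfl, hm⟩ := S.ker_of_ne_zero hk (f := f ∘ₗ LinearMap.fst A X Y) hf'
      have hfs : Function.Surjective f := fun y => by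
        obtain ⟨x, hx⟩ := hs y
        exact ⟨x.1, hx⟩
      let e : LinearMap.ker (f ∘ₗ LinearMap.fst A X Y) ≃ₗ[A] LinearMap.ker f × Y :=
        { toFun := fun x => (⟨x.1.1, x.2⟩, x.1.2)
          map_add' := fun _ _ => rfl
          map_smul' := fun _ _ => rfl
          invFun := fun x => ⟨(x.1.1, x.2), x.1.2⟩
          left_inv := fun _ => rfl
          right_inv := fun _ => rfl }
      obtain ⟨⟨p, hp⟩, hq⟩ := ih m (by omega) (X := ModuleCat.of A (LinearMap.ker f)) (Y := Y)
        (hm.family_of_lower.of_equiv e)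
      exact ⟨⟨p + 1, .succ _ _ _ _ _ (isShortExact_ker hfs) hp ⟨k, rfl⟩⟩, hq⟩
    rcases subsingleton_or_nontrivial (X × Y) with hs | hs
    · refine ⟨⟨0, .zero _ ⟨fun a b => ?_⟩⟩, ⟨0, .zero _ ⟨fun a b => ?_⟩⟩⟩
      · exact congrArg Prod.fst (Subsingleton.elim (a, (0 : Y)) (b, 0))
      · exact congrArg Prod.snd (Subsingleton.elim ((0 : X), a) (0, b))
    · obtain ⟨k, hk, f, hf⟩ := S.exists_ne_zero hX hs
      let g : X × Y →ₗ[A] Ψ k := f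
      by_cases h1 : g ∘ₗ LinearMap.inl A X Y = 0
      · have h2 : g ∘ₗ LinearMap.inr A X Y ≠ 0 := fun h2 => hf <| LinearMap.prod_ext h1 h2
        exact (step (hk.of_equiv (LinearEquiv.prodComm A X Y)) _ h2).symm
      · exact step hk _ h1

theorem filtration_of_retract (hX : HasFiltration (familyClass Ψ) n X)
    (hY : IsRetractOf (A := A) Y X) : ∃ m, HasFiltration (familyClass Ψ) m Y := by
  obtain ⟨a, p, hap⟩ := hY
  have hp : ∀ y, p (a y) = y := LinearMap.congr_fun hap
  let e : X ≃ₗ[A] Y × LinearMap.ker p :=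
    { toFun := fun x => (p x, ⟨x - a (p x), by simp [hp]⟩)
      map_add' := fun x y => Prod.ext (map_add _ _ _) (Subtype.ext (by simp; abel))
      map_smul' := fun r x => Prod.ext (map_smul _ _ _) (Subtype.ext (by simp [smul_sub]))
      invFun := fun z => a z.1 + z.2.1
      left_inv := fun x => by simp
      right_inv := fun z => by
        have : p z.2.1 = 0 := z.2.2
        exact Prod.ext (by simp [hp]) (Subtype.ext (by simp [hp])) }
  exact (S.filtration_of_prod (X := Y) (Y := ModuleCat.of A (LinearMap.ker p))
    (hX.of_equiv e)).1

/-- Filtered modules are generated by the images of the `Q j`. -/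
theorem iSup_range_cover (hX : HasFiltration (lowerClass Ψ i) n X) :
    ⨆ (j : {j // j ≤ i}) (f : Q j →ₗ[A] X), LinearMap.range f = ⊤ := by
  induction hX with
  | zero X h => exact Subsingleton.elim (α := Submodule A X) _ _
  | succ N X Y a b h hN hY ih =>
    rw [eq_top_iff]
    obtain ⟨j, hj, rfl⟩ := hY
    obtain ⟨Z, m, α, β, hβ, hZ⟩ := S.cover j
    -- Relative projectivity of `Q j` lifts its map onto the top factor to `X`; every element of `X`
    -- is then in the image of `Q j` up to an element of `N`.
    obtain ⟨ψ, hψ⟩ := h.exists_lift_of_ext (S.ext_cover_filtered hN.family_of_lower j) β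
    intro x _
    obtain ⟨q, hq⟩ := hβ.surjective (b x)
    have hx : b (x - ψ q) = 0 := by
      rw [map_sub, ← hq, ← hψ]
      exact sub_self _
    obtain ⟨y, hy⟩ := (h.exact _).1 hx
    rw [← sub_add_cancel x (ψ q)]
    refine add_mem ?_ ?_
    · rw [← hy]
      have hy' : a y ∈ (⊤ : Submodule A N).map a := ⟨y, trivial, rfl⟩
      rw [← ih, Submodule.map_iSup] at hy'
      revert hy'
      apply iSup_le (fun l => ?_) (a := ⨆ (j : {j // j ≤ i}) (f : Q j →ₗ[A] X), LinearMap.range f)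
      rw [Submodule.map_iSup]
      refine iSup_le fun f => le_trans ?_ (le_iSup_of_le l
        (le_iSup (fun f : Q l →ₗ[A] X => LinearMap.range f) (a ∘ₗ f)))
      rw [LinearMap.range_comp]
    · have h1 : LinearMap.range ψ ≤ ⨆ (j : {j // j ≤ i}) (f : Q j →ₗ[A] X), LinearMap.range f :=
        le_iSup_of_le ⟨j, hj⟩ (le_iSup (fun f : Q j →ₗ[A] X => LinearMap.range f) ψ)
      exact h1 ⟨q, rfl⟩

end IsBrickSystem

end BrickSystems

section Retracts

variable {A : Type*} [Ring A] {X Y Z W : Type*} [AddCommGroup X] [AddCommGroup Y] [AddCommGroup Z]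
  [AddCommGroup W] [Module A X] [Module A Y] [Module A Z] [Module A W]

theorem IsRetractOf.trans (h : IsRetractOf (A := A) X Y) (h' : IsRetractOf (A := A) Y Z) :
    IsRetractOf (A := A) X Z := by
  obtain ⟨i, p, hip⟩ := h
  obtain ⟨j, q, hjq⟩ := h'
  refine ⟨j ∘ₗ i, p ∘ₗ q, LinearMap.ext fun x => ?_⟩
  have h1 := LinearMap.congr_fun hjq (i x)
  have h2 := LinearMap.congr_fun hip x
  simp only [LinearMap.comp_apply, LinearMap.id_apply] at h1 h2 ⊢
  rw [h1, h2]

theorem IsRetractOf.of_equiv (e : X ≃ₗ[A] Y) : IsRetractOf (A := A) X Y :=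
  ⟨e.toLinearMap, e.symm.toLinearMap, LinearMap.ext fun x => by simp⟩

theorem IsRetractOf.prod (h : IsRetractOf (A := A) X Y) (h' : IsRetractOf (A := A) Z W) :
    IsRetractOf (A := A) (X × Z) (Y × W) := by
  obtain ⟨i, p, hip⟩ := h
  obtain ⟨j, q, hjq⟩ := h'
  refine ⟨i.prodMap j, p.prodMap q, LinearMap.ext fun x => ?_⟩
  exact Prod.ext (LinearMap.congr_fun hip x.1) (LinearMap.congr_fun hjq x.2)

theorem IsRetractOf.fst : IsRetractOf (A := A) X (X × Y) :=
  ⟨LinearMap.inl A X Y, LinearMap.fst A X Y, LinearMap.ext fun _ => rfl⟩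

theorem IsRetractOf.snd : IsRetractOf (A := A) Y (X × Y) :=
  ⟨LinearMap.inr A X Y, LinearMap.snd A X Y, LinearMap.ext fun _ => rfl⟩

end Retracts

/-! ### Pushouts and the horseshoe lemmas -/

section Pushouts

variable {A : Type*} [Ring A] {X Y Z W V : Type*} [AddCommGroup X] [AddCommGroup Y] [AddCommGroup Z]
  [AddCommGroup W] [AddCommGroup V] [Module A X] [Module A Y] [Module A Z] [Module A W] [Module A V]

/-- The pushout of `Y ← X → Z` fits into two exact sequences when both maps are injective. -/
theorem IsShortExact.exists_pushout {f : X →ₗ[A] Y} {p : Y →ₗ[A] W} (hf : IsShortExact f p)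
    {g : X →ₗ[A] Z} {q : Z →ₗ[A] V} (hg : IsShortExact g q) :
    ∃ (N : Submodule A (Y × Z)) (b : Y →ₗ[A] (Y × Z) ⧸ N) (b' : ((Y × Z) ⧸ N) →ₗ[A] V)
      (c : Z →ₗ[A] (Y × Z) ⧸ N) (c' : ((Y × Z) ⧸ N) →ₗ[A] W),
      IsShortExact b b' ∧ IsShortExact c c' := by
  -- The antidiagonal copy of `X` in `Y × Z`.
  let N := LinearMap.range (f.prod (-g))
  have hmem : ∀ y z, ((y, z) : Y × Z) ∈ N ↔ ∃ x, f x = y ∧ -g x = z := fun y z => by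
    simp [N, LinearMap.mem_range, Prod.ext_iff]
  refine ⟨N, N.mkQ ∘ₗ LinearMap.inl A Y Z, N.liftQ (q ∘ₗ LinearMap.snd A Y Z) ?_,
    N.mkQ ∘ₗ LinearMap.inr A Y Z, N.liftQ (p ∘ₗ LinearMap.fst A Y Z) ?_, ⟨?_, ?_, ?_⟩,
    ⟨?_, ?_, ?_⟩⟩
  · rintro ⟨y, z⟩ h
    obtain ⟨x, rfl, rfl⟩ := (hmem y z).1 h
    simp [hg.exact.apply_apply_eq_zero]
  · rintro ⟨y, z⟩ h
    obtain ⟨x, rfl, rfl⟩ := (hmem y z).1 h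
    simp [hf.exact.apply_apply_eq_zero]
  · refine (injective_iff_map_eq_zero _).2 fun y hy => ?_
    obtain ⟨x, rfl, hx⟩ := (hmem y 0).1 ((Submodule.Quotient.mk_eq_zero _).1 hy)
    rw [hg.injective (a₁ := x) (a₂ := 0) (by rw [map_zero, ← neg_eq_zero, hx]), map_zero]
  · intro e
    obtain ⟨⟨y, z⟩, rfl⟩ := Submodule.mkQ_surjective _ e
    change q z = 0 ↔ _
    rw [hg.exact z]
    constructor
    · rintro ⟨x, rfl⟩
      refine ⟨y + f x, (Submodule.Quotient.eq _).2 ?_⟩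
      exact (hmem _ _).2 ⟨x, by simp, by simp⟩
    · rintro ⟨y', hy'⟩
      obtain ⟨x, -, hx⟩ := (hmem _ _).1 ((Submodule.Quotient.eq _).1 hy')
      exact ⟨x, neg_injective (by simpa using hx)⟩
  · intro v
    obtain ⟨z, rfl⟩ := hg.surjective v
    exact ⟨N.mkQ (0, z), rfl⟩
  · refine (injective_iff_map_eq_zero _).2 fun z hz => ?_
    obtain ⟨x, hx, rfl⟩ := (hmem 0 z).1 ((Submodule.Quotient.mk_eq_zero _).1 hz)
    rw [hf.injective (a₁ := x) (a₂ := 0) (by rw [map_zero, hx]), map_zero, neg_zero]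
  · intro e
    obtain ⟨⟨y, z⟩, rfl⟩ := Submodule.mkQ_surjective _ e
    change p y = 0 ↔ _
    rw [hf.exact y]
    constructor
    · rintro ⟨x, rfl⟩
      refine ⟨z + g x, (Submodule.Quotient.eq _).2 ?_⟩
      exact (hmem _ _).2 ⟨-x, by simp, by simp⟩
    · rintro ⟨z', hz'⟩
      obtain ⟨x, hx, -⟩ := (hmem _ _).1 ((Submodule.Quotient.eq _).1 hz')
      refine ⟨-x, ?_⟩
      rw [map_neg, hx]
      simp
  · intro w
    obtain ⟨y, rfl⟩ := hf.surjective w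
    exact ⟨N.mkQ (y, 0), rfl⟩

/-- The horseshoe lemma for a lift of the right-hand surjection. -/
theorem IsShortExact.horseshoe {f : X →ₗ[A] Y} {g : Y →ₗ[A] Z} (h : IsShortExact f g)
    {K P K' P' : Type*} [AddCommGroup K] [AddCommGroup P] [AddCommGroup K'] [AddCommGroup P']
    [Module A K] [Module A P] [Module A K'] [Module A P'] {k : K →ₗ[A] P} {p : P →ₗ[A] X}
    (hp : IsShortExact k p) {k' : K' →ₗ[A] P'} {p' : P' →ₗ[A] Z} (hp' : IsShortExact k' p')
    (φ : P' →ₗ[A] Y) (hφ : g ∘ₗ φ = p') :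
    ∃ π : P × P' →ₗ[A] Y, Function.Surjective π ∧
      ∃ (a : K →ₗ[A] LinearMap.ker π) (b : LinearMap.ker π →ₗ[A] K'), IsShortExact a b := by
  have hφ' : ∀ x, g (φ x) = p' x := LinearMap.congr_fun hφ
  let π : P × P' →ₗ[A] Y := (f ∘ₗ p).coprod φ
  have hπ : ∀ x y, π (x, y) = f (p x) + φ y := fun _ _ => rfl
  refine ⟨π, fun y => ?_, ?_⟩
  · obtain ⟨v, hv⟩ := hp'.surjective (g y)
    obtain ⟨x, hx⟩ := (h.exact (y - φ v)).1 (by rw [map_sub, hφ', hv, sub_self])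
    obtain ⟨w, rfl⟩ := hp.surjective x
    exact ⟨(w, v), by rw [hπ, hx, sub_add_cancel]⟩
  · let a : K →ₗ[A] LinearMap.ker π :=
      (LinearMap.inl A P P' ∘ₗ k).codRestrict _ fun x => by
        simp [hπ, hp.exact.apply_apply_eq_zero]
    have hker : p' ∘ₗ LinearMap.snd A P P' ∘ₗ (LinearMap.ker π).subtype = 0 := by
      refine LinearMap.ext fun ⟨⟨x, y⟩, hxy⟩ => ?_
      have : g (f (p x) + φ y) = 0 := by
        rw [← hπ, show π (x, y) = 0 from hxy, map_zero]
      rw [map_add, h.exact.apply_apply_eq_zero, zero_add, hφ'] at this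
      exact this
    obtain ⟨b, hb⟩ := hp'.exists_lift _ hker
    have hb' : ∀ z, k' (b z) = z.1.2 := LinearMap.congr_fun hb
    refine ⟨a, b, fun x y hxy => ?_, ?_, ?_⟩
    · exact hp.injective (congrArg Prod.fst (congrArg Subtype.val hxy))
    · rintro ⟨⟨x, y⟩, hxy⟩
      rw [← map_eq_zero_iff k' hp'.injective, hb']
      constructor
      · rintro (rfl : y = 0)
        have hx : f (p x) = 0 := by
          have : f (p x) + φ 0 = 0 := hxy
          rwa [map_zero, add_zero] at this
        obtain ⟨z, rfl⟩ := (hp.exact x).1 (h.injective (by rw [hx, map_zero]))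
        exact ⟨z, rfl⟩
      · rintro ⟨z, hz⟩
        exact (congrArg Prod.snd (congrArg Subtype.val hz)).symm
    · intro y
      obtain ⟨x, hx⟩ := (h.exact (φ (k' y))).1 (by rw [hφ', hp'.exact.apply_apply_eq_zero])
      obtain ⟨w, rfl⟩ := hp.surjective x
      refine ⟨⟨(-w, k' y), ?_⟩, hp'.injective (hb' _)⟩
      rw [LinearMap.mem_ker, hπ, map_neg, map_neg, hx, neg_add_cancel]

/-- The horseshoe lemma for an extension of the left-hand injection. -/
theorem IsShortExact.cohorseshoe {f : X →ₗ[A] Y} {g : Y →ₗ[A] Z} (h : IsShortExact f g)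
    {I C I' C' : Type*} [AddCommGroup I] [AddCommGroup C] [AddCommGroup I'] [AddCommGroup C']
    [Module A I] [Module A C] [Module A I'] [Module A C'] {i : X →ₗ[A] I} {c : I →ₗ[A] C}
    (hi : IsShortExact i c) {i' : Z →ₗ[A] I'} {c' : I' →ₗ[A] C'} (hi' : IsShortExact i' c')
    (φ : Y →ₗ[A] I) (hφ : φ ∘ₗ f = i) :
    ∃ j : Y →ₗ[A] I × I', Function.Injective j ∧
      ∃ (a : C →ₗ[A] (I × I') ⧸ LinearMap.range j) (b : ((I × I') ⧸ LinearMap.range j) →ₗ[A] C'),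
        IsShortExact a b := by
  have hφ' : ∀ x, φ (f x) = i x := LinearMap.congr_fun hφ
  let j : Y →ₗ[A] I × I' := φ.prod (i' ∘ₗ g)
  have hj : ∀ y, j y = (φ y, i' (g y)) := fun _ => rfl
  have hji : Function.Injective j := by
    refine (injective_iff_map_eq_zero _).2 fun y hy => ?_
    rw [hj, Prod.mk_eq_zero, map_eq_zero_iff i' hi'.injective] at hy
    obtain ⟨x, rfl⟩ := (h.exact y).1 hy.2
    rw [hφ', map_eq_zero_iff i hi.injective] at hy
    rw [hy.1, map_zero]
  let q := (LinearMap.range j).mkQ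
  have hq : ∀ z, q z = 0 ↔ ∃ y, j y = z := fun z => Submodule.Quotient.mk_eq_zero _
  obtain ⟨a, ha⟩ := hi.exists_desc (q ∘ₗ LinearMap.inl A I I') (LinearMap.ext fun x =>
    (hq _).2 ⟨f x, by rw [hj, hφ', h.exact.apply_apply_eq_zero, map_zero]; rfl⟩)
  obtain ⟨b, hb⟩ := (isShortExact_range_mkQ hji).exists_desc (c' ∘ₗ LinearMap.snd A I I')
    (LinearMap.ext fun y => hi'.exact.apply_apply_eq_zero (g y))
  have ha' : ∀ x, a (c x) = q (x, 0) := LinearMap.congr_fun ha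
  have hb' : ∀ z, b (q z) = c' z.2 := LinearMap.congr_fun hb
  refine ⟨j, hji, a, b, ?_, ?_, ?_⟩
  · refine (injective_iff_map_eq_zero _).2 fun x hx => ?_
    obtain ⟨x, rfl⟩ := hi.surjective x
    rw [ha', hq] at hx
    obtain ⟨y, hy⟩ := hx
    rw [hj, Prod.mk.injEq, map_eq_zero_iff i' hi'.injective] at hy
    obtain ⟨z, rfl⟩ := (h.exact y).1 hy.2
    rw [← hy.1, hφ', hi.exact.apply_apply_eq_zero]
  · intro z
    obtain ⟨⟨x, y⟩, rfl⟩ := Submodule.mkQ_surjective _ z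
    rw [show b (Submodule.mkQ _ (x, y)) = c' y from hb' _, hi'.exact y]
    constructor
    · rintro ⟨z, rfl⟩
      obtain ⟨w, rfl⟩ := h.surjective z
      refine ⟨c (x - φ w), (ha' _).trans ((Submodule.Quotient.eq _).2 ⟨-w, ?_⟩)⟩
      rw [hj]
      ext <;> simp
    · rintro ⟨x', hx'⟩
      obtain ⟨x', rfl⟩ := hi.surjective x'
      rw [ha'] at hx'
      obtain ⟨w, hw⟩ := (Submodule.Quotient.eq _).1 hx'
      refine ⟨-g w, ?_⟩
      have h2 := congrArg Prod.snd hw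
      rw [hj] at h2
      simp only [Prod.snd_sub, zero_sub] at h2
      rw [map_neg, h2, neg_neg]
  · intro y
    obtain ⟨x, rfl⟩ := hi'.surjective y
    exact ⟨q (0, x), hb' _⟩

end Pushouts

/-! ### Auslander–Buchweitz approximation relative to an injective cogenerator -/

section CotiltingPairs

variable {A : Type u} [Ring A]

/-- The direct summands of the finite powers of `T`. -/
def PowerSummand (T : ModuleCat.{u} A) : ObjectProperty (ModuleCat.{u} A) :=
  fun W => ∃ n : ℕ, IsRetractOf (A := A) W (Fin n → T)

/-- `M` has an `n`-th syzygy in `C`, formed with projective modules in `C`. -/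
inductive SyzygyDim (C : ObjectProperty (ModuleCat.{u} A)) : ℕ → ModuleCat.{u} A → Prop
  | zero (M : ModuleCat.{u} A) (hM : C M) : SyzygyDim C 0 M
  | succ {n : ℕ} (K P M : ModuleCat.{u} A) (f : K →ₗ[A] P) (g : P →ₗ[A] M)
      (h : IsShortExact f g) (hK : SyzygyDim C n K) (hP : C P) (hproj : Module.Projective A P) :
      SyzygyDim C (n + 1) M

/-- `C` is closed under extensions, direct summands and some syzygies, and the powers of `T` are
an injective cogenerator of `C`. -/
structure IsCotiltingPair (C : ObjectProperty (ModuleCat.{u} A)) (T : ModuleCat.{u} A) : Prop where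
  zero : ∀ M : ModuleCat.{u} A, Subsingleton M → C M
  extension : ∀ (X Y Z : ModuleCat.{u} A) (f : X →ₗ[A] Y) (g : Y →ₗ[A] Z), IsShortExact f g →
    C X → C Z → C Y
  retract : ∀ X Y : ModuleCat.{u} A, IsRetractOf (A := A) X Y → C Y → C X
  mem : C T
  ext : ∀ X : ModuleCat.{u} A, C X → ∀ n, 0 < n → Subsingleton (Ext X T n)
  cosyzygy : ∀ X : ModuleCat.{u} A, C X → ∃ (W Y : ModuleCat.{u} A) (f : X →ₗ[A] W) (g : W →ₗ[A] Y),
    IsShortExact f g ∧ PowerSummand T W ∧ C Y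
  syzygy : ∀ X : ModuleCat.{u} A, C X → ∃ (K P : ModuleCat.{u} A) (f : K →ₗ[A] P) (g : P →ₗ[A] X),
    IsShortExact f g ∧ C K ∧ C P ∧ Module.Projective A P

theorem isShortExact_finCons {T : Type*} [AddCommGroup T] [Module A T] (n : ℕ) :
    ∃ (f : T →ₗ[A] Fin (n + 1) → T) (g : (Fin (n + 1) → T) →ₗ[A] Fin n → T), IsShortExact f g := by
  refine ⟨LinearMap.single A (fun _ => T) 0, LinearMap.funLeft A T Fin.succ,
    fun a b hab => by simpa using congrFun hab 0, fun x => ⟨fun hx => ⟨x 0, ?_⟩, ?_⟩, fun x => ⟨Fin.cons 0 x, rfl⟩⟩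
  · funext k
    refine Fin.cases (by simp) (fun k => ?_) k
    have := congrFun hx k
    simpa using this.symm
  · rintro ⟨y, rfl⟩
    funext k
    simp [LinearMap.funLeft_apply]

variable {C : ObjectProperty (ModuleCat.{u} A)} {T M X Y Z : ModuleCat.{u} A} {n : ℕ}

theorem PowerSummand.zero (hM : Subsingleton M) : PowerSummand T M :=
  ⟨0, 0, 0, LinearMap.ext fun _ => Subsingleton.elim _ _⟩

theorem PowerSummand.prod (hX : PowerSummand T X) (hY : PowerSummand T Y) :
    PowerSummand T (ModuleCat.of A (X × Y)) := by
  obtain ⟨n, hn⟩ := hX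
  obtain ⟨m, hm⟩ := hY
  exact ⟨n + m, (hn.prod hm).trans (IsRetractOf.of_equiv
    ((LinearEquiv.sumArrowLequivProdArrow (Fin n) (Fin m) A T).symm.trans
      (LinearEquiv.funCongrLeft A T finSumFinEquiv.symm)))⟩

theorem PowerSummand.of_retract (hX : IsRetractOf (A := A) X T) : PowerSummand T X :=
  ⟨1, hX.trans (IsRetractOf.of_equiv (LinearEquiv.funUnique (Fin 1) A T).symm)⟩

theorem PowerSummand.retract (hX : PowerSummand T X) (hY : IsRetractOf (A := A) Y X) :
    PowerSummand T Y := by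
  obtain ⟨n, hn⟩ := hX
  exact ⟨n, hY.trans hn⟩

theorem PowerSummand.ext {m : ℕ} (hX : PowerSummand T X) (hM : Subsingleton (Ext M T m)) :
    Subsingleton (Ext M X m) := by
  obtain ⟨n, hn⟩ := hX
  refine ext_subsingleton_of_retract_right (X := ModuleCat.of A (Fin n → T)) hn ?_
  clear hn
  induction n with
  | zero => exact ext_subsingleton_of_subsingleton_right (inferInstanceAs (Subsingleton (Fin 0 → T))) m
  | succ n ih =>
    obtain ⟨f, g, h⟩ := isShortExact_finCons (A := A) (T := T) n
    exact IsShortExact.ext_middle_right (X := T) (Y := ModuleCat.of A (Fin (n + 1) → T))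
      (Z := ModuleCat.of A (Fin n → T)) h m hM ih

theorem HasFiniteResolution.mono {C C' : ObjectProperty (ModuleCat.{u} A)}
    (h : ∀ M, C M → C' M) (hM : HasFiniteResolution C M) : HasFiniteResolution C' M := by
  induction hM with
  | of_mem X hX => exact .of_mem X (h X hX)
  | step K C₀ X f g hf hfg hg hC₀ hK ih => exact .step K C₀ X f g hf hfg hg (h _ hC₀) ih

namespace IsCotiltingPair

variable (S : IsCotiltingPair C T)

include S

theorem powerSummand_mem (hX : PowerSummand T X) : C X := by
  obtain ⟨n, hn⟩ := hX
  refine S.retract X (ModuleCat.of A (Fin n → T)) hn ?_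
  clear hn
  induction n with
  | zero => exact S.zero _ (inferInstanceAs (Subsingleton (Fin 0 → T)))
  | succ n ih =>
    obtain ⟨f, g, h⟩ := isShortExact_finCons (A := A) (T := T) n
    exact S.extension T (ModuleCat.of A (Fin (n + 1) → T)) (ModuleCat.of A (Fin n → T)) f g h
      S.mem ih

theorem prod_mem (hX : C X) (hY : C Y) : C (ModuleCat.of A (X × Y)) :=
  S.extension X (ModuleCat.of A (X × Y)) Y _ _ isShortExact_inl_snd hX hY

/-- A module in `C` has a further syzygy in `C`. Thus a bound may be raised, and finitely many
bounds may be replaced by their maximum. -/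
theorem syzygyDim_succ (hM : SyzygyDim C n M) : SyzygyDim C (n + 1) M := by
  induction hM with
  | zero M h =>
    obtain ⟨K, P, f, g, h, hK, hP, hproj⟩ := S.syzygy M h
    exact .succ K P M f g h (.zero K hK) hP hproj
  | succ K P M f g h hK hP hproj ih => exact .succ K P M f g h ih hP hproj

theorem syzygyDim_mono {m : ℕ} (hM : SyzygyDim C n M) (h : n ≤ m) : SyzygyDim C m M := by
  induction h with
  | refl => exact hM
  | step _ ih => exact S.syzygyDim_succ ih

theorem syzygyDim_extension {f : X →ₗ[A] Y} {g : Y →ₗ[A] Z} (h : IsShortExact f g)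
    (hX : SyzygyDim C n X) (hZ : SyzygyDim C n Z) : SyzygyDim C n Y := by
  induction n generalizing X Y Z with
  | zero =>
    cases hX with
    | zero _ hX => cases hZ with
      | zero _ hZ => exact .zero _ (S.extension X Y Z f g h hX hZ)
  | succ n ih =>
    cases hX with
    | succ K P _ k p hp hK hP hproj => cases hZ with
      | succ K' P' _ k' p' hp' hK' hP' hproj' =>
        obtain ⟨φ, hφ⟩ := Module.projective_lifting_property g p' h.surjective
        obtain ⟨π, hπ, a, b, hab⟩ := h.horseshoe hp hp' φ hφ
        exact .succ (ModuleCat.of A (LinearMap.ker π)) (ModuleCat.of A (P × P')) Y _ π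
          (isShortExact_ker hπ) (ih hab hK hK') (S.prod_mem hP hP')
          (inferInstanceAs (Module.Projective A (P × P')))

/-- For a projective cover term `P → Y` with kernel `K`, both from `C`, the kernel of `P → Z` is an
extension of `X` by `K`, hence has the same bound as `X`. -/
theorem syzygyDim_third {f : X →ₗ[A] Y} {g : Y →ₗ[A] Z} (h : IsShortExact f g)
    (hX : SyzygyDim C n X) (hY : C Y) : SyzygyDim C (n + 1) Z := by
  obtain ⟨K, P, k, p, hp, hK, hP, hproj⟩ := S.syzygy Y hY
  obtain ⟨e⟩ := h.equiv_ker
  have hs : Function.Surjective (g ∘ₗ p) := by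
    rw [LinearMap.coe_comp]
    exact h.surjective.comp hp.surjective
  refine .succ (ModuleCat.of A (LinearMap.ker (g ∘ₗ p))) P Z _ _ (isShortExact_ker hs) ?_ hP hproj
  exact S.syzygyDim_extension ((hp.preimage g).congr (LinearEquiv.refl A K) e.symm)
    (S.syzygyDim_mono (.zero K hK) (Nat.zero_le n)) hX

theorem ext_eq_zero_of_syzygyDim (hM : SyzygyDim C n M) {m : ℕ} (h : n < m) :
    Subsingleton (Ext M T m) := by
  induction hM generalizing m with
  | zero M hM => exact S.ext M hM m h
  | succ K P M f g hfg hK hP hproj ih =>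
    obtain ⟨m, rfl⟩ := Nat.exists_eq_succ_of_ne_zero (by omega : m ≠ 0)
    exact hfg.ext_third_left m (ih (by omega))
      (ext_subsingleton_of_projective (Nat.succ_pos m) hproj)

theorem ext_resolution {m : ℕ} (hm : 0 < m) (hX : C X)
    (hY : HasFiniteResolution (PowerSummand T) Y) : Subsingleton (Ext X Y m) := by
  induction hY generalizing m with
  | of_mem Y hY => exact hY.ext (S.ext X hX m hm)
  | step K C₀ Y f g hf hfg hg hC₀ hK ih =>
    exact IsShortExact.ext_third_right ⟨hf, hfg, hg⟩ m (ih (Nat.succ_pos m))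
      (hC₀.ext (S.ext X hX m hm))

/-- Approximation by a module in `C`, with kernel resolved by powers of `T`. -/
theorem exists_approximation (hM : SyzygyDim C n M) :
    ∃ (Y X : ModuleCat.{u} A) (f : Y →ₗ[A] X) (g : X →ₗ[A] M), IsShortExact f g ∧
      HasFiniteResolution (PowerSummand T) Y ∧ C X := by
  induction hM with
  | zero M hM =>
    have h0 : Subsingleton (ModuleCat.of A PUnit.{u + 1}) :=
      inferInstanceAs (Subsingleton PUnit)
    exact ⟨ModuleCat.of A PUnit, M, 0, LinearMap.id, isShortExact_zero_id,
      .of_mem _ (PowerSummand.zero h0), hM⟩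
  | succ K P M k p hp hK hP hproj ih =>
    obtain ⟨Y, X, f, g, hfg, hY, hX⟩ := ih
    -- The approximation `0 → Y → X → K → 0` of the syzygy is changed into an embedding of `K` in
    -- `W/Y` with cokernel `X'` in `C`; the module `W/Y` is resolved by powers of `T`.
    obtain ⟨W, X', w, v, hwv, hW, hX'⟩ := S.cosyzygy X hX
    obtain ⟨φ, ψ, hφ⟩ := hwv.quotient_range hfg
    have hV := HasFiniteResolution.step Y W (ModuleCat.of A (W ⧸ LinearMap.range (w ∘ₗ f)))
      (w ∘ₗ f) (Submodule.mkQ _) (hwv.injective.comp hfg.injective)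
      (LinearMap.exact_map_mkQ_range _) (Submodule.mkQ_surjective _) hW hY
    -- The pushout of `P ← K → W/Y` is an extension of `X'` by `P`, so it lies in `C`, and it maps
    -- onto `M` with kernel `W/Y`.
    obtain ⟨N, b, b', c, c', hb, hc⟩ := hp.exists_pushout hφ
    exact ⟨_, ModuleCat.of A ((P × (W ⧸ LinearMap.range (w ∘ₗ f))) ⧸ N), c, c', hc, hV,
      S.extension P (ModuleCat.of A ((P × (W ⧸ LinearMap.range (w ∘ₗ f))) ⧸ N)) X' b b' hb hP hX'⟩

/-- The embedding of `X` into a summand of a power of `T` has cokernel in `C`, so it splits. -/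
theorem powerSummand_of_ext (hX : C X) (hE : ∀ Y, C Y → Subsingleton (Ext Y X 1)) :
    PowerSummand T X := by
  obtain ⟨W, Y, w, v, h, hW, hY⟩ := S.cosyzygy X hX
  obtain ⟨r, hr⟩ := h.exists_extend (hE Y hY) LinearMap.id
  exact hW.retract ⟨w, r, hr⟩

/-- The syzygy `K` inherits the vanishing, so `K` is in `C` by induction and embeds in some `W` with
cokernel in `C`. The pushout of `P ← K → W` lies in `C`, and it splits over `M` since `Ext¹(M, W) =
0`. -/
theorem mem_of_ext (hM : SyzygyDim C n M) (hE : ∀ m, 0 < m → Subsingleton (Ext M T m)) :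
    C M := by
  induction hM with
  | zero M hM => exact hM
  | succ K P M k p hp hK hP hproj ih =>
    have hCK : C K := ih fun m hm => hp.ext_first_left m
      (ext_subsingleton_of_projective hm hproj) (hE (m + 1) (Nat.succ_pos m))
    obtain ⟨W, X, w, v, hwv, hW, hX⟩ := S.cosyzygy K hCK
    obtain ⟨N, b, b', c, c', hb, hc⟩ := hp.exists_pushout hwv
    have hE' := S.extension P (ModuleCat.of A ((P × W) ⧸ N)) X b b' hb hP hX
    obtain ⟨s, hs⟩ := IsShortExact.exists_lift_of_ext (X := W) (Y := ModuleCat.of A ((P × W) ⧸ N))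
      hc (M := M) (hW.ext (hE 1 one_pos)) LinearMap.id
    exact S.retract M _ ⟨s, c', hs⟩ hE'

/-- In the approximation `0 → Y → X → M → 0` both outer terms have no `Ext¹` from `C`, hence neither
has `X`, and `X` is a summand of a power of `T`. -/
theorem resolution_of_injective (hM : SyzygyDim C n M) (hI : Module.Injective A M) :
    HasFiniteResolution (PowerSummand T) M := by
  obtain ⟨Y, X, f, g, h, hY, hX⟩ := S.exists_approximation hM
  refine .step Y X M f g h.injective h.exact h.surjective (S.powerSummand_of_ext hX
    fun Z hZ => h.ext_middle_right 1 (S.ext_resolution one_pos hZ hY)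
      (ext_subsingleton_of_injective one_pos hI)) hY

end IsCotiltingPair

/-- Passing to cosyzygies reduces to `n = 0`, where Baer's criterion only involves the cyclic
modules `A/I`. So it is enough to test finitely generated modules. -/
theorem hasInjectiveDimensionLE_of_ext {N : ModuleCat.{u} A} {n : ℕ}
    (hN : ∀ M : ModuleCat.{u} A, Module.Finite A M → Subsingleton (Ext M N (n + 1))) :
    HasInjectiveDimensionLE N n := by
  induction n generalizing N with
  | zero =>
    have : Module.Injective A N := by
      apply Module.Baer.injective
      intro I g
      have hI := hN (ModuleCat.of A (A ⧸ I)) (inferInstanceAs (Module.Finite A (A ⧸ I)))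
      obtain ⟨ψ, hψ⟩ := IsShortExact.exists_extend (X := ModuleCat.of A I) (Y := ModuleCat.of A A)
        (Z := ModuleCat.of A (A ⧸ I)) (isShortExact_mkQ I) hI g
      exact ⟨ψ, fun x hx => LinearMap.congr_fun hψ ⟨x, hx⟩⟩
    have : Injective N := (Module.injective_iff_injective_object A N).1 this
    exact inferInstanceAs (HasInjectiveDimensionLT N 1)
  | succ n ih =>
    let E := Injective.under N
    have hinj : Function.Injective (Injective.ι N).hom :=
      (ModuleCat.mono_iff_injective _).1 inferInstance
    have hE : Module.Injective A E := (Module.injective_iff_injective_object A E).2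
      (inferInstanceAs (Injective (Injective.under N)))
    obtain ⟨V, q, h⟩ : ∃ (V : ModuleCat.{u} A) (q : E →ₗ[A] V),
        IsShortExact (Injective.ι N).hom q :=
      ⟨ModuleCat.of A (E ⧸ LinearMap.range (Injective.ι N).hom), _, isShortExact_range_mkQ hinj⟩
    have hV : HasInjectiveDimensionLE V n := ih fun M hM =>
      h.ext_third_right (n + 1) (hN M hM) (ext_subsingleton_of_injective (Nat.succ_pos n) hE)
    exact h.shortExact.hasInjectiveDimensionLT_X₁ (n + 1) hV
      (hasInjectiveDimensionLT_of_ge E 1 _ (by omega))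

end CotiltingPairs

/-! ### Fitting's lemma and cancellation of indecomposable summands -/

section KrullSchmidt

variable {A : Type*} [Ring A] {M X Y : Type*} [AddCommGroup M] [Module A M] [AddCommGroup X]
  [Module A X] [AddCommGroup Y] [Module A Y]

/-- `M` has no proper decomposition into two complementary submodules. -/
def HasTrivialDecompositions (A M : Type*) [Ring A] [AddCommGroup M] [Module A M] : Prop :=
  ∀ p q : Submodule A M, IsCompl p q → p = ⊥ ∨ q = ⊥

/-- Fitting's lemma: `M` is the direct sum of the kernel and the image of a high power of `f`, so
one of the two vanishes. -/
theorem HasTrivialDecompositions.isNilpotent_or_bijective [IsArtinian A M] [IsNoetherian A M]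
    (hM : HasTrivialDecompositions A M) (f : Module.End A M) :
    IsNilpotent f ∨ Function.Bijective f := by
  obtain ⟨n, hn⟩ := Filter.eventually_atTop.1 (f.eventually_isCompl_ker_pow_range_pow)
  rcases hM _ _ (hn (n + 1) (Nat.le_succ n)) with h | h
  · refine .inr (IsArtinian.bijective_of_injective_endomorphism f ?_)
    rw [LinearMap.ker_eq_bot, pow_succ, Module.End.mul_eq_comp, LinearMap.coe_comp] at h
    exact h.of_comp
  · exact .inl ⟨n + 1, LinearMap.range_eq_bot.1 h⟩

theorem IsRetractOf.of_bijective (j : M →ₗ[A] X) (q : X →ₗ[A] M)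
    (hb : Function.Bijective (q ∘ₗ j)) : IsRetractOf (A := A) M X :=
  ⟨j, (LinearEquiv.ofBijective _ hb).symm.toLinearMap ∘ₗ q, LinearMap.ext fun x =>
    (LinearEquiv.ofBijective _ hb).symm_apply_apply x⟩

/-- The identity of `M` is a sum of endomorphisms `a` and `b` that factor through `X` and `Y`. If
`a` is nilpotent, then `b = 1 - a` is invertible; otherwise `a` itself is. -/
theorem HasTrivialDecompositions.retract_of_prod [IsArtinian A M] [IsNoetherian A M]
    (hM : HasTrivialDecompositions A M) (h : IsRetractOf (A := A) M (X × Y)) :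
    IsRetractOf (A := A) M X ∨ IsRetractOf (A := A) M Y := by
  obtain ⟨i, p, hip⟩ := h
  let a : Module.End A M := (p ∘ₗ LinearMap.inl A X Y) ∘ₗ (LinearMap.fst A X Y ∘ₗ i)
  let b : Module.End A M := (p ∘ₗ LinearMap.inr A X Y) ∘ₗ (LinearMap.snd A X Y ∘ₗ i)
  have hab : b = 1 - a := by
    rw [eq_sub_iff_add_eq]
    refine LinearMap.ext fun x => ?_
    have : p ((0, (i x).2) + ((i x).1, 0)) = x := by
      simpa using LinearMap.congr_fun hip x
    rwa [map_add] at this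
  rcases hM.isNilpotent_or_bijective a with ha | ha
  · refine .inr (.of_bijective (LinearMap.snd A X Y ∘ₗ i) (p ∘ₗ LinearMap.inr A X Y) ?_)
    have : IsUnit b := hab ▸ ha.isUnit_one_sub
    exact (Module.End.isUnit_iff b).1 this
  · exact .inl (.of_bijective (LinearMap.fst A X Y ∘ₗ i) (p ∘ₗ LinearMap.inl A X Y) ha)

theorem HasTrivialDecompositions.retract_of_pi [IsArtinian A M] [IsNoetherian A M]
    (hM : HasTrivialDecompositions A M) (hM' : Nontrivial M) {n : ℕ}
    (h : IsRetractOf (A := A) M (Fin n → X)) : IsRetractOf (A := A) M X := by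
  induction n with
  | zero =>
    obtain ⟨i, p, hip⟩ := h
    obtain ⟨x, hx⟩ := exists_ne (0 : M)
    refine (hx ?_).elim
    rw [← LinearMap.id_apply (R := A) x, ← hip, LinearMap.comp_apply, Subsingleton.elim (i x) 0,
      map_zero]
  | succ n ih =>
    have h' := h.trans (.of_equiv ((LinearEquiv.funCongrLeft A X finSumFinEquiv).trans
      (LinearEquiv.sumArrowLequivProdArrow (Fin n) (Fin 1) A X)))
    rcases hM.retract_of_prod h' with h' | h'
    · exact ih h'
    · exact h'.trans (.of_equiv (LinearEquiv.funUnique (Fin 1) A X))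

end KrullSchmidt

/-! ### Summands of powers of a module versus its additive closure -/

section AddClosures

variable {A : Type u} [Ring A] {M X Y : ModuleCat.{u} A}

theorem IsSummandOf.isRetractOf (h : IsSummandOf X M) : IsRetractOf (A := A) X M := by
  obtain ⟨Y, ⟨e⟩⟩ := h
  exact IsRetractOf.fst.trans (.of_equiv e)

theorem IsRetractOf.isSummandOf (h : IsRetractOf (A := A) X M) : IsSummandOf X M := by
  obtain ⟨a, p, hap⟩ := h
  have hp : ∀ y, p (a y) = y := LinearMap.congr_fun hap
  exact ⟨ModuleCat.of A (LinearMap.ker p), ⟨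
    { toFun := fun z => a z.1 + z.2.1
      map_add' := fun x y => by simp; abel
      map_smul' := fun r x => by simp
      invFun := fun x => (p x, ⟨x - a (p x), by simp [hp]⟩)
      left_inv := fun z => by
        have : p z.2.1 = 0 := z.2.2
        exact Prod.ext (by simp [hp]) (Subtype.ext (by simp [hp]))
      right_inv := fun x => by simp }⟩⟩

theorem AddClosure.of_pi {κ : Type} [Finite κ] (Y : κ → ModuleCat.{u} A)
    (hY : ∀ k, IsSummandOf (Y k) M) (e : X ≃ₗ[A] ∀ k, Y k) : AddClosure M X := by
  obtain ⟨n, ⟨σ⟩⟩ := Finite.exists_equiv_fin κ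
  exact ⟨n, fun k => Y (σ.symm k), fun k => hY _, ⟨e.trans
    ((LinearEquiv.piCongrLeft' A (fun k => Y k) σ).trans
      (DirectSum.linearEquivFunOnFintype A (Fin n) fun k => Y (σ.symm k)).symm)⟩⟩

theorem AddClosure.exists_pi (h : AddClosure M X) : ∃ (n : ℕ) (Y : Fin n → ModuleCat.{u} A),
    (∀ k, IsSummandOf (Y k) M) ∧ Nonempty (X ≃ₗ[A] ∀ k, Y k) := by
  obtain ⟨n, Y, hY, ⟨e⟩⟩ := h
  exact ⟨n, Y, hY, ⟨e.trans (DirectSum.linearEquivFunOnFintype A (Fin n) fun k => Y k)⟩⟩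

theorem AddClosure.of_equiv (h : AddClosure M X) (e : X ≃ₗ[A] Y) : AddClosure M Y := by
  obtain ⟨n, Z, hZ, ⟨e'⟩⟩ := h
  exact ⟨n, Z, hZ, ⟨e.symm.trans e'⟩⟩

theorem AddClosure.prod (hX : AddClosure M X) (hY : AddClosure M Y) :
    AddClosure M (ModuleCat.of A (X × Y)) := by
  obtain ⟨n, V, hV, ⟨e⟩⟩ := hX.exists_pi
  obtain ⟨m, W, hW, ⟨e'⟩⟩ := hY.exists_pi
  refine AddClosure.of_pi (κ := Fin n ⊕ Fin m) (Sum.elim V W) (by rintro (k | k); exacts [hV k, hW k])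
    ((e.prodCongr e').trans
      (LinearEquiv.sumPiEquivProdPi A (Fin n) (Fin m) fun k => (Sum.elim V W k : ModuleCat.{u} A)).symm)

theorem AddClosure.of_subsingleton (hX : Subsingleton X) : AddClosure M X :=
  AddClosure.of_pi (κ := Fin 0) Fin.elim0 (fun k => k.elim0)
    { (0 : X →ₗ[A] _) with
      invFun := 0
      left_inv := fun _ => Subsingleton.elim _ _
      right_inv := fun _ => Subsingleton.elim _ _ }

theorem AddClosure.of_retract (hX : IsRetractOf (A := A) X M) : AddClosure M X :=
  AddClosure.of_pi (κ := Fin 1) (fun _ => X) (fun _ => hX.isSummandOf)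
    (LinearEquiv.funUnique (Fin 1) A X).symm

/-- Existence of indecomposable decompositions, by induction on submodules of `X`: an indecomposable
summand of a power of `M` is a summand of `M`, and a decomposable one splits into smaller pieces. -/
theorem PowerSummand.addClosure [IsArtinian A X] [IsNoetherian A X] (hX : PowerSummand M X) :
    AddClosure M X := by
  have key : ∀ N : Submodule A X, PowerSummand M (ModuleCat.of A N) →
      AddClosure M (ModuleCat.of A N) := by
    intro N
    induction N using WellFoundedLT.induction with
    | _ N ih =>
      intro hN
      rcases subsingleton_or_nontrivial N with hs | hs
      · exact .of_subsingleton hs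
      · by_cases hd : HasTrivialDecompositions A N
        · obtain ⟨n, hn⟩ := hN
          exact .of_retract (hd.retract_of_pi hs hn)
        · simp only [HasTrivialDecompositions, not_forall, not_or] at hd
          obtain ⟨p, q, hpq, hp, hq⟩ := hd
          have hlt : ∀ p : Submodule A N, p ≠ ⊤ → p.map N.subtype < N := by
            intro p hp
            refine lt_of_le_of_ne (Submodule.map_subtype_le N p) fun h => hp ?_
            refine Submodule.map_injective_of_injective N.subtype_injective ?_
            rw [h, Submodule.map_top, Submodule.range_subtype]
          have e : ∀ p : Submodule A N, p ≃ₗ[A] p.map N.subtype := fun p =>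
            p.equivMapOfInjective _ N.subtype_injective
          have e' := Submodule.prodEquivOfIsCompl p q hpq
          have h1 := ih _ (hlt p fun h => hq (by simpa [h] using hpq.disjoint))
            ((hN.retract (Y := ModuleCat.of A p) (IsRetractOf.fst.trans (.of_equiv e'))).retract
              (.of_equiv (e p).symm))
          have h2 := ih _ (hlt q fun h => hp (by simpa [h] using hpq.disjoint))
            ((hN.retract (Y := ModuleCat.of A q) (IsRetractOf.snd.trans (.of_equiv e'))).retract
              (.of_equiv (e q).symm))
          exact (h1.prod h2).of_equiv (((e p).symm.prodCongr (e q).symm).trans e')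
  exact (key ⊤ (hX.retract (.of_equiv Submodule.topEquiv))).of_equiv Submodule.topEquiv

theorem AddClosure.powerSummand (hX : AddClosure M X) : PowerSummand M X := by
  obtain ⟨n, Y, hY, ⟨e⟩⟩ := hX.exists_pi
  refine ⟨n, (IsRetractOf.of_equiv e).trans ?_⟩
  choose i p hip using fun k => (hY k).isRetractOf
  exact ⟨LinearMap.pi fun k => i k ∘ₗ LinearMap.proj k,
    LinearMap.pi fun k => p k ∘ₗ LinearMap.proj k, LinearMap.ext fun x => funext fun k =>
      LinearMap.congr_fun (hip k) (x k)⟩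

theorem CategoryTheory.Indecomposable.hasTrivialDecompositions (h : Indecomposable X) :
    HasTrivialDecompositions A X := by
  intro p q hpq
  have e := Submodule.prodEquivOfIsCompl p q hpq
  have hz := h.2 (ModuleCat.of A p) (ModuleCat.of A q)
    (e.symm.toModuleIso ≪≫ (ModuleCat.biprodIsoProd (ModuleCat.of A p) (ModuleCat.of A q)).symm)
  rcases hz with hz | hz
  · exact .inl ((Submodule.subsingleton_iff_eq_bot (p := p)).1 (ModuleCat.subsingleton_of_isZero hz))
  · exact .inr ((Submodule.subsingleton_iff_eq_bot (p := q)).1 (ModuleCat.subsingleton_of_isZero hz))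

end AddClosures

/-! ### The dual of the regular module is an injective cogenerator of finite length -/

section RegularDuals

variable {R : Type u} [CommRing R] {J : Type u} [AddCommGroup J] [Module R J]
  {A : Type u} [Ring A] [Algebra R A]

/-- The underlying linear map of an element of `D(A)`. -/
def RegularDual.toLinearMap (f : RegularDual R J A) : A →ₗ[R] J := f

/-- The element of `D(A)` given by a linear map. -/
def RegularDual.ofLinearMap (f : A →ₗ[R] J) : RegularDual R J A := f

theorem RegularDual.smul_apply (a : A) (f : RegularDual R J A) (x : A) :
    (a • f).toLinearMap x = f.toLinearMap (x * a) := rfl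

theorem RegularDual.ext {f g : RegularDual R J A}
    (h : ∀ x, f.toLinearMap x = g.toLinearMap x) : f = g :=
  LinearMap.ext (f := f.toLinearMap) (g := g.toLinearMap) h

/-- By adjunction, `A`-linear maps to `Hom_R(A, J)` are `R`-linear maps to `J`, via evaluation at
`1`. Extending the latter verifies Baer's criterion. -/
theorem regularDual_injective (hJ : Module.Injective R J) :
    Module.Injective A (RegularDual R J A) := by
  apply Module.Baer.injective
  intro I g
  let φ : I.restrictScalars R →ₗ[R] J :=
    { toFun := fun a => (g a).toLinearMap 1
      map_add' := fun a b => by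
        have : g (a + b) = g a + g b := map_add g a b
        exact (congrArg (fun z => RegularDual.toLinearMap z 1) this)
      map_smul' := fun r a => by
        have h1 : (show I from r • a) = algebraMap R A r • (show I from a) :=
          Subtype.ext (Algebra.smul_def r (a : A))
        have : g (show I from r • a) = algebraMap R A r • g a :=
          (congrArg g h1).trans (map_smul g _ _)
        refine (congrArg (fun z => RegularDual.toLinearMap z 1) this).trans ?_
        simp only [RegularDual.smul_apply, one_mul, RingHom.id_apply]
        rw [Algebra.algebraMap_eq_smul_one, map_smul] }
  obtain ⟨h, hh⟩ := hJ.out (I.restrictScalars R).subtype Subtype.coe_injective φ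
  refine ⟨LinearMap.toSpanSingleton A (RegularDual R J A) (.ofLinearMap h), fun x hx => ?_⟩
  refine RegularDual.ext fun y => ?_
  rw [LinearMap.toSpanSingleton_apply, RegularDual.smul_apply]
  have h1 := hh ⟨y * x, I.mul_mem_left y hx⟩
  have h2 : g ⟨y * x, I.mul_mem_left y hx⟩ = y • g ⟨x, hx⟩ := by
    rw [← map_smul]; rfl
  refine h1.trans ((congrArg (fun z => RegularDual.toLinearMap z 1) h2).trans ?_)
  rw [RegularDual.smul_apply, one_mul]

/-- Since `R/rad R` is essential in `J`, a map from a simple module to `J` takes values in it.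
Evaluation at a generator thus embeds these maps in the noetherian module `R/rad R`, and the general
case follows along a composition series. -/
theorem isNoetherian_linearMap_of_isFiniteLength [IsNoetherianRing R] (hJ : IsInjectiveEnvelope R (R ⧸ Ring.jacobson R) J)
    {M : Type*} [AddCommGroup M] [Module R M] (hM : IsFiniteLength R M) :
    IsNoetherian R (M →ₗ[R] J) := by
  obtain ⟨-, e, he, hess⟩ := hJ
  induction hM with
  | of_subsingleton => infer_instance
  | @of_simple_quotient M _ _ N hS hN ih =>
    have hQ : IsNoetherian R ((M ⧸ N) →ₗ[R] J) := by
      have := hS.nontrivial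
      obtain ⟨s, hs⟩ := exists_ne (0 : M ⧸ N)
      have hr : ∀ f : (M ⧸ N) →ₗ[R] J, f s ∈ LinearMap.range e := by
        intro f
        by_cases hf : f = 0
        · rw [hf]; exact zero_mem _
        have hfi := LinearMap.injective_of_ne_zero hf
        have hne := hess (LinearMap.range f) fun h => hf (LinearMap.range_eq_bot.1 h)
        have htop : (LinearMap.range e).comap f = ⊤ := by
          refine (eq_bot_or_eq_top _).resolve_left fun h => hne ?_
          rw [eq_bot_iff]
          rintro _ ⟨⟨x, rfl⟩, hx⟩
          have : x ∈ (LinearMap.range e).comap f := hx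
          rw [h] at this
          rw [(Submodule.mem_bot R).1 this, map_zero]
          exact zero_mem _
        have hs' : s ∈ (LinearMap.range e).comap f := htop ▸ trivial
        exact hs'
      refine isNoetherian_of_injective
        ((LinearMap.applyₗ s : ((M ⧸ N) →ₗ[R] J) →ₗ[R] J).codRestrict (LinearMap.range e) hr)
        fun f g hfg => ?_
      refine LinearMap.ext_on (IsSimpleModule.span_singleton_eq_top R hs) ?_
      rintro _ rfl
      exact congrArg Subtype.val hfg
    refine isNoetherian_of_range_eq_ker (LinearMap.lcomp R J N.mkQ) (LinearMap.lcomp R J N.subtype) ?_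
    ext f
    constructor
    · rintro ⟨g, rfl⟩
      refine LinearMap.ext fun x => ?_
      change g (N.mkQ x) = 0
      rw [show N.mkQ x = 0 from (Submodule.Quotient.mk_eq_zero N).2 x.2, map_zero]
    · intro hf
      refine ⟨N.liftQ f fun x hx => LinearMap.congr_fun hf ⟨x, hx⟩, ?_⟩
      exact LinearMap.ext fun _ => rfl

variable [IsArtinianRing R]

theorem finite_regularDual (hJ : IsInjectiveEnvelope R (R ⧸ Ring.jacobson R) J)
    [Module.Finite R A] : Module.Finite A (RegularDual R J A) := by
  have : IsNoetherianRing R := inferInstance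
  have : IsNoetherian R (A →ₗ[R] J) := isNoetherian_linearMap_of_isFiniteLength hJ
    (isFiniteLength_iff_isNoetherian_isArtinian.2 ⟨inferInstance, inferInstance⟩)
  obtain ⟨s, hs⟩ := (inferInstance : Module.Finite R (A →ₗ[R] J)).fg_top
  let t : Finset (RegularDual R J A) := s
  have key : ∀ f : A →ₗ[R] J, f ∈ Submodule.span R (s : Set (A →ₗ[R] J)) →
      RegularDual.ofLinearMap f ∈ Submodule.span A (t : Set (RegularDual R J A)) := by
    intro f hf
    induction hf using Submodule.span_induction with
    | mem x h => exact Submodule.subset_span h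
    | zero => exact zero_mem _
    | add x y _ _ hx hy => exact add_mem hx hy
    | smul r x _ hx =>
      have : RegularDual.ofLinearMap (r • x) = algebraMap R A r • RegularDual.ofLinearMap x := by
        refine RegularDual.ext fun y => ?_
        rw [RegularDual.smul_apply, ← Algebra.commutes, ← Algebra.smul_def, map_smul]
        rfl
      rw [this]
      exact Submodule.smul_mem _ _ hx
  exact ⟨⟨t, eq_top_iff.2 fun f _ => key f (hs ▸ trivial)⟩⟩

/-- Every nonzero `A`-module has a nonzero map to `D(A)`. -/
theorem exists_ne_zero_regularDual (hJ : IsInjectiveEnvelope R (R ⧸ Ring.jacobson R) J)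
    {S : Type u} [AddCommGroup S] [Module A S] [Nontrivial S] :
    ∃ f : S →ₗ[A] RegularDual R J A, f ≠ 0 := by
  obtain ⟨hinj, e, he, -⟩ := hJ
  let _ : Module R S := Module.compHom S (algebraMap R A)
  have hsm : ∀ (r : R) (x : S), r • x = algebraMap R A r • x := fun _ _ => rfl
  have : IsScalarTower R A S := ⟨fun r a x => by rw [hsm, Algebra.smul_def, mul_smul]⟩
  obtain ⟨s, hs⟩ := exists_ne (0 : S)
  let φ := LinearMap.toSpanSingleton R S s
  have hφ : LinearMap.ker φ ≠ ⊤ := fun h => hs (by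
    have : (1 : R) ∈ LinearMap.ker φ := h ▸ trivial
    simpa [φ] using this)
  obtain ⟨m, hm, hle⟩ := Ideal.exists_le_maximal (LinearMap.ker φ) hφ
  have hss : IsSemisimpleModule R (R ⧸ Ring.jacobson R) :=
    IsArtinian.isSemisimpleModule_iff_jacobson R _ |>.2 (Module.jacobson_quotient_jacobson R R)
  have hjm : Ring.jacobson R ≤ LinearMap.ker m.mkQ := by
    rw [Submodule.ker_mkQ]
    exact Ring.jacobson_le_of_isMaximal m
  let π : (R ⧸ Ring.jacobson R) →ₗ[R] R ⧸ m := (Ring.jacobson R).liftQ m.mkQ hjm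
  have hπ : Function.Surjective π := fun x => by
    obtain ⟨r, rfl⟩ := Submodule.mkQ_surjective m x
    exact ⟨(Ring.jacobson R).mkQ r, rfl⟩
  -- Semisimplicity of `R/rad R` embeds the residue field `R/m` in it, hence in `J`. This gives a
  -- map `Rs → R/m → J` nonzero at `s`, which extends to `S` by injectivity of `J`.
  obtain ⟨σ, hσ⟩ := IsSemisimpleModule.lifting_property π hπ LinearMap.id
  have hσi : Function.Injective σ := fun x y hxy => by
    have hx := LinearMap.congr_fun hσ x
    have hy := LinearMap.congr_fun hσ y
    simp only [LinearMap.comp_apply, LinearMap.id_apply] at hx hy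
    rw [← hx, ← hy, hxy]
  let g : (R ⧸ LinearMap.ker φ) →ₗ[R] J :=
    (LinearMap.ker φ).liftQ (e ∘ₗ σ ∘ₗ m.mkQ) fun x hx => by
      have : m.mkQ x = 0 := (Submodule.Quotient.mk_eq_zero m).2 (hle hx)
      simp only [LinearMap.mem_ker, LinearMap.comp_apply]
      rw [this, map_zero, map_zero]
  obtain ⟨h, hh⟩ := hinj.out ((LinearMap.ker φ).liftQ φ le_rfl)
    (LinearMap.ker_eq_bot.1 (Submodule.ker_liftQ_eq_bot' _ φ rfl)) g
  have hhs : h s ≠ 0 := by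
    have h1 := hh ((LinearMap.ker φ).mkQ 1)
    have h2 : g ((LinearMap.ker φ).mkQ 1) = e (σ (m.mkQ 1)) := rfl
    have h3 : (LinearMap.ker φ).liftQ φ le_rfl ((LinearMap.ker φ).mkQ 1) = s := one_smul R s
    rw [h3, h2] at h1
    rw [h1]
    intro h0
    rw [← map_zero e] at h0
    have h4 := he h0
    rw [← map_zero σ] at h4
    exact hm.ne_top ((Ideal.eq_top_iff_one m).2 ((Submodule.Quotient.mk_eq_zero m).1 (hσi h4)))
  let f : S →ₗ[A] RegularDual R J A :=
    { toFun := fun x => (h ∘ₗ (LinearMap.toSpanSingleton A S x).restrictScalars R : A →ₗ[R] J)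
      map_add' := fun x y => RegularDual.ext fun a =>
        (congrArg h (smul_add a x y)).trans (map_add h _ _)
      map_smul' := fun b x => RegularDual.ext fun a => congrArg h (smul_smul a b x) }
  refine ⟨f, fun hf => hhs ?_⟩
  have h1 : (f s).toLinearMap 1 = h s := congrArg h (one_smul A s)
  rw [← h1, hf]
  rfl

end RegularDuals

/-! ### Socles of indecomposable injective modules -/

section InjectiveModules

variable {A : Type u} [Ring A]

theorem Module.Injective.of_retract {M I : Type u} [AddCommGroup M] [Module A M] [AddCommGroup I]
    [Module A I] (hI : Module.Injective A I) (h : IsRetractOf (A := A) M I) :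
    Module.Injective A M := by
  obtain ⟨i, p, hip⟩ := h
  refine ⟨fun X Y _ _ _ _ f hf g => ?_⟩
  obtain ⟨k, hk⟩ := hI.out f hf (i ∘ₗ g)
  exact ⟨p ∘ₗ k, fun x => by
    rw [LinearMap.comp_apply, hk]
    exact LinearMap.congr_fun hip (g x)⟩

/-- The simple submodules of an indecomposable injective module are isomorphic. -/
theorem HasTrivialDecompositions.simple_unique {I S S' : Type u} [AddCommGroup I] [Module A I]
    [AddCommGroup S] [Module A S] [AddCommGroup S'] [Module A S'] [IsArtinian A I]
    [IsNoetherian A I] (hI : Module.Injective A I) (hd : HasTrivialDecompositions A I)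
    [IsSimpleModule A S] [IsSimpleModule A S'] {a : S →ₗ[A] I} {b : S' →ₗ[A] I}
    (ha : Function.Injective a) (hb : Function.Injective b) : Nonempty (S ≃ₗ[A] S') := by
  have hS := IsSimpleModule.nontrivial A S
  have hS' := IsSimpleModule.nontrivial A S'
  by_cases hc : Function.Injective (a.coprod b)
  -- If `S ⊕ S'` embeds in `I`, its projection to `S` extends to an endomorphism of `I` that fixes a
  -- nonzero element and kills another one, so it is neither nilpotent nor bijective.
  · exfalso
    obtain ⟨h, hh⟩ := hI.out (a.coprod b) hc (a ∘ₗ LinearMap.fst A S S')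
    have h1 : ∀ x, h (a x) = a x := fun x => by simpa using hh (x, 0)
    have h2 : ∀ x, h (b x) = 0 := fun x => by simpa using hh (0, x)
    rcases hd.isNilpotent_or_bijective h with ⟨n, hn⟩ | hbij
    · obtain ⟨x, hx⟩ := exists_ne (0 : S)
      have h3 : ∀ n : ℕ, (h ^ n) (a x) = a x := fun n => by
        induction n with
        | zero => rfl
        | succ n ih => rw [pow_succ, Module.End.mul_apply, h1, ih]
      have h4 := h3 n
      rw [hn, LinearMap.zero_apply] at h4
      exact hx (ha (by rw [← h4, map_zero]))
    · obtain ⟨x, hx⟩ := exists_ne (0 : S')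
      exact hx (hb (hbij.1 (by rw [h2, map_zero, map_zero])))
  · have hne : (LinearMap.range b).comap a ≠ ⊥ := by
      intro h
      refine hc ((injective_iff_map_eq_zero _).2 ?_)
      rintro ⟨x, y⟩ hxy
      rw [LinearMap.coprod_apply] at hxy
      have hx : x ∈ (LinearMap.range b).comap a :=
        ⟨-y, by rw [map_neg, ← eq_neg_of_add_eq_zero_left hxy]⟩
      rw [h, Submodule.mem_bot] at hx
      subst hx
      rw [map_zero, zero_add] at hxy
      exact Prod.ext rfl (hb (hxy.trans (map_zero b).symm))
    have htop := (eq_bot_or_eq_top _).resolve_left hne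
    have hr : ∀ x, a x ∈ LinearMap.range b := fun x => by
      have : x ∈ (LinearMap.range b).comap a := htop ▸ trivial
      exact this
    let c : S →ₗ[A] S' := (LinearEquiv.ofInjective b hb).symm.toLinearMap ∘ₗ a.codRestrict _ hr
    have hci : Function.Injective c := (LinearEquiv.ofInjective b hb).symm.injective.comp
      fun x y hxy => ha (congrArg Subtype.val hxy)
    have hc0 : c ≠ 0 := fun h0 => by
      obtain ⟨x, hx⟩ := exists_ne (0 : S)
      exact hx (hci (by rw [h0]; rfl))
    exact ⟨LinearEquiv.ofBijective c (LinearMap.bijective_of_ne_zero hc0)⟩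

/-- A nonzero map to a module of finite length is nonzero to some indecomposable summand. -/
theorem exists_indecomposable_retract {M S : Type u} [AddCommGroup M] [Module A M]
    [AddCommGroup S] [Module A S] [IsArtinian A M] {f : S →ₗ[A] M} (hf : f ≠ 0) :
    ∃ N : Submodule A M, IsRetractOf (A := A) N M ∧ HasTrivialDecompositions A N ∧
      ∃ g : S →ₗ[A] N, g ≠ 0 := by
  -- A minimal summand among those receiving a nonzero map from `S` is indecomposable: in a
  -- decomposition one of the components of the map is nonzero, and that part must be everything.
  obtain ⟨N, ⟨hN, g, hg⟩, hmin⟩ := IsArtinian.set_has_minimal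
    {N : Submodule A M | IsRetractOf (A := A) N M ∧ ∃ g : S →ₗ[A] N, g ≠ 0}
    ⟨⊤, .of_equiv Submodule.topEquiv, f.codRestrict ⊤ fun _ => trivial, fun h => hf <|
      LinearMap.ext fun x => congrArg Subtype.val (LinearMap.congr_fun h x)⟩
  refine ⟨N, hN, ?_, g, hg⟩
  have key : ∀ p : Submodule A N, IsRetractOf (A := A) p N → ∀ g : S →ₗ[A] p, g ≠ 0 → p = ⊤ := by
    intro p hp g hg
    by_contra hne
    refine hmin (p.map N.subtype) ⟨?_, ?_⟩ ?_
    · exact (IsRetractOf.of_equiv (p.equivMapOfInjective _ N.subtype_injective).symm).trans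
        (hp.trans hN)
    · refine ⟨(p.equivMapOfInjective _ N.subtype_injective).toLinearMap ∘ₗ g, fun h => hg ?_⟩
      refine LinearMap.ext fun x => (p.equivMapOfInjective _ N.subtype_injective).injective ?_
      rw [LinearMap.zero_apply, map_zero]
      exact LinearMap.congr_fun h x
    · refine lt_of_le_of_ne (Submodule.map_subtype_le N p) fun h => hne ?_
      refine Submodule.map_injective_of_injective N.subtype_injective ?_
      rw [h, Submodule.map_top, Submodule.range_subtype]
  intro p q hpq
  have e := Submodule.prodEquivOfIsCompl p q hpq
  by_cases h1 : LinearMap.fst A p q ∘ₗ e.symm.toLinearMap ∘ₗ g = 0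
  · have h2 : LinearMap.snd A p q ∘ₗ e.symm.toLinearMap ∘ₗ g ≠ 0 := fun h2 => hg <|
      LinearMap.ext fun x => e.symm.injective (by
        rw [LinearMap.zero_apply, map_zero]
        exact Prod.ext (LinearMap.congr_fun h1 x) (LinearMap.congr_fun h2 x))
    have := key q (IsRetractOf.snd.trans (.of_equiv e)) _ h2
    exact .inl (by simpa [this] using hpq.disjoint)
  · have := key p (IsRetractOf.fst.trans (.of_equiv e)) _ h1
    exact .inr (by simpa [this] using hpq.disjoint)

end InjectiveModules

/-! ### The Grothendieck group is spanned by the simple modules -/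

section GrothendieckGroups

variable {A : Type u} [Ring A]

/-- The class of a finitely generated module in the Grothendieck group. -/
def grothendieckClass (M : Type u) [AddCommGroup M] [Module A M] (hM : Module.Finite A M) :
    GrothendieckGroup A :=
  QuotientAddGroup.mk (FreeAbelianGroup.of ⟨ModuleCat.of A M, hM⟩)

theorem IsShortExact.grothendieckClass_eq {X Y Z : Type u} [AddCommGroup X] [AddCommGroup Y]
    [AddCommGroup Z] [Module A X] [Module A Y] [Module A Z] {f : X →ₗ[A] Y} {g : Y →ₗ[A] Z}
    (h : IsShortExact f g) (hX : Module.Finite A X) (hY : Module.Finite A Y)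
    (hZ : Module.Finite A Z) :
    grothendieckClass Y hY = grothendieckClass X hX + grothendieckClass Z hZ := by
  refine eq_of_sub_eq_zero ((QuotientAddGroup.eq_zero_iff _).2 (AddSubgroup.subset_closure ?_))
  exact ⟨⟨ModuleCat.of A X, hX⟩, ⟨ModuleCat.of A Y, hY⟩, ⟨ModuleCat.of A Z, hZ⟩, f, g,
    h.injective, h.exact, h.surjective, rfl⟩

theorem grothendieckClass_eq_zero {X : Type u} [AddCommGroup X] [Module A X] [Subsingleton X]
    (hX : Module.Finite A X) : grothendieckClass X hX = 0 := by
  have := (isShortExact_id_zero (A := A) (X := X) (Z := X)).grothendieckClass_eq hX hX hX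
  exact left_eq_add.1 this

theorem grothendieckClass_congr {X Y : Type u} [AddCommGroup X] [AddCommGroup Y] [Module A X]
    [Module A Y] (e : X ≃ₗ[A] Y) (hX : Module.Finite A X) (hY : Module.Finite A Y) :
    grothendieckClass X hX = grothendieckClass Y hY := by
  have h := ((isShortExact_id_zero (A := A) (X := X) (Z := PUnit.{u + 1})).congr_middle e)
  have := h.grothendieckClass_eq hX hY inferInstance
  rw [this, grothendieckClass_eq_zero (X := PUnit.{u + 1}), add_zero]

/-- The Grothendieck group is generated by the classes of the simple modules. -/
theorem span_grothendieckClass_eq_top [IsArtinianRing A] {κ : Type} (S : κ → ModuleCat.{u} A)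
    (hfin : ∀ k, Module.Finite A (S k))
    (hS : ∀ M : ModuleCat.{u} A, IsSimpleModule A M → ∃ k, Nonempty (M ≃ₗ[A] S k)) :
    Submodule.span ℤ (Set.range fun k => grothendieckClass (S k) (hfin k)) = ⊤ := by
  have key : ∀ (M : Type u) [AddCommGroup M] [Module A M] (_ : IsFiniteLength A M)
      (hM : Module.Finite A M), grothendieckClass M hM ∈
        Submodule.span ℤ (Set.range fun k => grothendieckClass (S k) (hfin k)) := by
    intro M _ _ h
    induction h with
    | of_subsingleton =>
      intro hM
      rw [grothendieckClass_eq_zero]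
      exact zero_mem _
    | @of_simple_quotient M _ _ N hs hN ih =>
      intro hM
      obtain ⟨h1, h2⟩ := isFiniteLength_iff_isNoetherian_isArtinian.1 hN
      rw [(isShortExact_mkQ N).grothendieckClass_eq inferInstance hM inferInstance]
      obtain ⟨k, ⟨e⟩⟩ := hS (ModuleCat.of A (M ⧸ N)) hs
      refine add_mem (ih _) ?_
      rw [grothendieckClass_congr e _ (hfin k)]
      exact Submodule.subset_span ⟨k, rfl⟩
  rw [eq_top_iff]
  intro x _
  obtain ⟨y, rfl⟩ := QuotientAddGroup.mk_surjective x
  induction y using FreeAbelianGroup.induction_on with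
  | zero => exact zero_mem _
  | of M =>
    have := M.2
    exact key M.1 (isFiniteLength_iff_isNoetherian_isArtinian.2 ⟨inferInstance, inferInstance⟩) M.2
  | neg M h => exact neg_mem (h trivial)
  | add x y hx hy => exact add_mem (hx trivial) (hy trivial)

theorem rank_grothendieckGroup_le [IsArtinianRing A] {κ : Type} [Fintype κ]
    (S : κ → ModuleCat.{u} A) (hfin : ∀ k, Module.Finite A (S k))
    (hS : ∀ M : ModuleCat.{u} A, IsSimpleModule A M → ∃ k, Nonempty (M ≃ₗ[A] S k)) :
    Module.rank ℤ (GrothendieckGroup A) ≤ (Fintype.card κ : Cardinal) := by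
  rw [← rank_top, ← span_grothendieckClass_eq_top S hfin hS]
  refine (rank_span_le _).trans ?_
  have := Cardinal.mk_range_le_lift (f := fun k => grothendieckClass (S k) (hfin k))
  simpa using this

end GrothendieckGroups

/-! ### The rank argument -/

section InjectiveCogenerators

variable {A : Type u} [Ring A] {ι : Type} [LinearOrder ι] [Fintype ι]
  {Ψ Q : ι → ModuleCat.{u} A} {I : ModuleCat.{u} A} {n : ℕ}

/-- If an injective cogenerator is filtered, each `Ψ i` embeds into one of its summands with
filtered cokernel. -/
theorem IsBrickSystem.exists_injective_cosyzygy [IsArtinianRing A] (S : IsBrickSystem Ψ Q)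
    (hΨ : ∀ i, Module.Finite A (Ψ i))
    (hI : HasFiltration (familyClass Ψ) n I) (hinj : Module.Injective A I)
    (hfin : Module.Finite A I)
    (hcog : ∀ M : ModuleCat.{u} A, IsSimpleModule A M → ∃ f : M →ₗ[A] I, f ≠ 0)
    (hrk : Module.rank ℤ (GrothendieckGroup A) = (Fintype.card ι : Cardinal)) (i : ι) :
    ∃ (W C : ModuleCat.{u} A) (f : Ψ i →ₗ[A] W) (g : W →ₗ[A] C) (m : ℕ), IsShortExact f g ∧
      IsRetractOf (A := A) W I ∧ HasFiltration (familyClass Ψ) m C := by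
  classical
  let P : ι → Prop := fun i => ∃ (W C : ModuleCat.{u} A) (f : Ψ i →ₗ[A] W) (g : W →ₗ[A] C) (m : ℕ),
    IsShortExact f g ∧ IsRetractOf (A := A) W I ∧ HasFiltration (familyClass Ψ) m C
  have hsub : ∀ i, ∃ N : Submodule A (Ψ i), IsSimpleModule A N := fun i => by
    have := S.nontrivial i
    have := hΨ i
    obtain ⟨N, hN⟩ := IsAtomic.exists_atom (Submodule A (Ψ i))
    exact ⟨N, isSimpleModule_iff_isAtom.2 hN⟩
  choose N hN using hsub
  -- A simple `M` embeds in an indecomposable summand of `I`, whose filtration starts with some `Ψ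
  -- k`. The chosen simple submodule of this `Ψ k` is then isomorphic to `M`.
  have hsimple : ∀ M : ModuleCat.{u} A, IsSimpleModule A M →
      ∃ k : {i // P i}, Nonempty (M ≃ₗ[A] ModuleCat.of A (N k)) := by
    intro M hM
    obtain ⟨f, hf⟩ := hcog M hM
    obtain ⟨W, hW, hd, g, hg⟩ := exists_indecomposable_retract hf
    obtain ⟨m, hm⟩ := S.filtration_of_retract hI (Y := ModuleCat.of A W) hW
    have hgi := LinearMap.injective_of_ne_zero hg
    have hnt := IsSimpleModule.nontrivial A M
    obtain ⟨_, C, a, b, l, ⟨k, rfl⟩, hab, hC⟩ := hm.exists_sub hgi.nontrivial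
    refine ⟨⟨k, ModuleCat.of A W, C, a, b, l, hab, hW, hC⟩, ?_⟩
    have := hN k
    exact hd.simple_unique (hinj.of_retract hW) hgi (b := a ∘ₗ (N k).subtype)
      (hab.injective.comp Subtype.coe_injective)
  have hle := rank_grothendieckGroup_le (fun k : {i // P i} => ModuleCat.of A (N k)) (fun k => by
    have := hN k
    exact inferInstanceAs (Module.Finite A (N k))) hsimple
  -- The simple submodules attached to the good indices span the Grothendieck group, so there are at
  -- least as many good indices as its rank, and none can be missing.
  rw [hrk, Nat.cast_le] at hle
  by_contra hi
  exact absurd hle (not_le.2 (Fintype.card_subtype_lt (p := P) hi))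

end InjectiveCogenerators

/-! ### The functor `F = Hom(Q, -)` and the projective modules `F(Q(i))` -/

namespace ProperCostratifyingSystem

variable {Λ : Type u} [Ring Λ] {ι : Type} [LinearOrder ι] (S : ProperCostratifyingSystem Λ ι)
  {X Y Z : ModuleCat.{u} Λ}

theorem isBrickSystem : IsBrickSystem S.Ψ S.Q where
  nontrivial i := by
    by_contra h
    rw [not_nontrivial_iff_subsingleton] at h
    obtain ⟨f, hf⟩ := @exists_ne _ (S.division_Ψ i).1 0
    exact hf (ModuleCat.hom_ext (LinearMap.ext fun _ => Subsingleton.elim _ _))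
  bijective i f hf := by
    have hu := (S.division_Ψ i).2 (End.of (ModuleCat.ofHom f)) fun h =>
      hf (congrArg ModuleCat.Hom.hom h)
    have : IsIso (ModuleCat.ofHom f) := (isUnit_iff_isIso _).1 hu
    exact ConcreteCategory.bijective_of_isIso (ModuleCat.ofHom f)
  hom_eq_zero i j h f := congrArg ModuleCat.Hom.hom (S.hom_Ψ i j h (ModuleCat.ofHom f))
  cover i := by
    obtain ⟨Z, α, β, h1, h2, h3, hZ⟩ := S.exact_Q i
    obtain ⟨n, hn⟩ := hZ.hasFiltration
    exact ⟨Z, n, α, β, ⟨h1, h2, h3⟩, hn⟩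
  ext_cover := S.ext_Q

/-- The map `F(X) → F(Y)` induced by a linear map. -/
noncomputable def mapF (f : X →ₗ[Λ] Y) : S.F.obj X →ₗ[S.Γ] S.F.obj Y :=
  (S.F.map (ModuleCat.ofHom f)).hom

/-- The linear map underlying an element of `F(X)`. -/
noncomputable def toLin (x : S.F.obj X) : S.sumQ →ₗ[Λ] X := ModuleCat.Hom.hom (show S.sumQ ⟶ X from x)

/-- The element of `F(X)` given by a linear map. -/
noncomputable def ofLin (f : S.sumQ →ₗ[Λ] X) : S.F.obj X := ModuleCat.ofHom f

/-- The element of `Γ` given by an endomorphism of `Q`. -/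
noncomputable def ofEnd (f : S.sumQ →ₗ[Λ] S.sumQ) : S.Γ := MulOpposite.op (End.of (ModuleCat.ofHom f))

variable {S}

@[simp] theorem toLin_ofLin (f : S.sumQ →ₗ[Λ] X) : S.toLin (S.ofLin f) = f := rfl

@[simp] theorem toLin_mapF (f : X →ₗ[Λ] Y) (x : S.F.obj X) :
    S.toLin (S.mapF f x) = f ∘ₗ S.toLin x := rfl

@[simp] theorem toLin_add (x y : S.F.obj X) : S.toLin (x + y) = S.toLin x + S.toLin y := rfl

@[simp] theorem toLin_ofEnd_smul (f : S.sumQ →ₗ[Λ] S.sumQ) (x : S.F.obj X) :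
    S.toLin (S.ofEnd f • x) = S.toLin x ∘ₗ f := rfl

theorem toLin_injective : Function.Injective (S.toLin : S.F.obj X → (S.sumQ →ₗ[Λ] X)) :=
  fun _ _ h => ModuleCat.hom_ext h

@[simp] theorem toLin_inj {x y : S.F.obj X} : S.toLin x = S.toLin y ↔ x = y :=
  toLin_injective.eq_iff

theorem mapF_comp (g : Y →ₗ[Λ] Z) (f : X →ₗ[Λ] Y) : S.mapF (g ∘ₗ f) = S.mapF g ∘ₗ S.mapF f :=
  rfl

theorem mapF_id : S.mapF (LinearMap.id : X →ₗ[Λ] X) = LinearMap.id := rfl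

theorem mapF_zero : S.mapF (0 : X →ₗ[Λ] Y) = 0 := rfl

variable (S)

/-- The inclusion `Q(i) → Q`. -/
noncomputable def incl (i : ι) : S.Q i →ₗ[Λ] S.sumQ := DirectSum.lof Λ ι (fun i => S.Q i) i

/-- The projection `Q → Q(i)`. -/
noncomputable def proj (i : ι) : S.sumQ →ₗ[Λ] S.Q i := DirectSum.component Λ ι (fun i => S.Q i) i

variable {S} in
theorem sumQ_hom_ext {f g : S.sumQ →ₗ[Λ] X} (h : ∀ i, f ∘ₗ S.incl i = g ∘ₗ S.incl i) : f = g :=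
  DirectSum.linearMap_ext (M := fun i => S.Q i) Λ h

variable {S} in
theorem exists_desc_sumQ (v : ∀ i, S.Q i →ₗ[Λ] X) :
    ∃ φ : S.sumQ →ₗ[Λ] X, ∀ i, φ ∘ₗ S.incl i = v i :=
  ⟨DirectSum.toModule (M := fun i => S.Q i) Λ ι X v, fun i => LinearMap.ext fun x =>
    DirectSum.toModule_lof (M := fun i => S.Q i) Λ (φ := v) i x⟩

theorem proj_comp_incl (i : ι) : S.proj i ∘ₗ S.incl i = LinearMap.id :=
  LinearMap.ext fun x => DirectSum.component.lof_self (R := Λ) (M := fun i => S.Q i) i x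

theorem proj_comp_incl_of_ne {i j : ι} (h : i ≠ j) : S.proj i ∘ₗ S.incl j = 0 :=
  LinearMap.ext fun x => (DirectSum.component.of (R := Λ) (M := fun i => S.Q i) i j x).trans
    (dif_neg h.symm)

theorem sum_incl_comp_proj [Fintype ι] : ∑ i, S.incl i ∘ₗ S.proj i = LinearMap.id := by
  refine sumQ_hom_ext fun j => LinearMap.ext fun x => ?_
  rw [LinearMap.comp_apply, LinearMap.sum_apply, Finset.sum_eq_single j]
  · exact congrArg (S.incl j) (LinearMap.congr_fun (S.proj_comp_incl j) x)
  · intro i _ hij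
    rw [LinearMap.comp_apply, show S.proj i (S.incl j x) = 0 from
      LinearMap.congr_fun (S.proj_comp_incl_of_ne hij) x, map_zero]
  · simp

/-- The generator of the projective `Γ`-module `F(Q(i))`. -/
noncomputable def gen (i : ι) : S.F.obj (S.Q i) := S.ofLin (S.proj i)

/-- The ring `Γ` acts by precomposition, so `F(Q(i))` is the left ideal of `Γ` cut out by the
idempotent of `Q(i)`, with the projection `Q → Q(i)` as generator. -/
theorem smul_gen {i : ι} (x : S.F.obj (S.Q i)) :
    S.ofEnd (S.incl i ∘ₗ S.toLin x) • S.gen i = x := by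
  rw [← toLin_inj, toLin_ofEnd_smul]
  change S.proj i ∘ₗ S.incl i ∘ₗ S.toLin x = _
  rw [← LinearMap.comp_assoc, proj_comp_incl, LinearMap.id_comp]

theorem idem_smul_gen (i : ι) : S.ofEnd (S.incl i ∘ₗ S.proj i) • S.gen i = S.gen i :=
  S.smul_gen (S.gen i)

variable {S}

theorem hom_ext_gen {N : Type*} [AddCommGroup N] [Module S.Γ N] {i : ι}
    {φ ψ : S.F.obj (S.Q i) →ₗ[S.Γ] N} (h : φ (S.gen i) = ψ (S.gen i)) : φ = ψ :=
  LinearMap.ext fun x => by rw [← S.smul_gen x, map_smul, map_smul, h]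

variable (S)

/-- The embedding of `F(Q(i))` as a summand of `Γ`. -/
noncomputable def toRing (i : ι) : S.F.obj (S.Q i) →ₗ[S.Γ] S.Γ where
  toFun x := S.ofEnd (S.incl i ∘ₗ S.toLin x)
  map_add' x y := by
    rw [toLin_add, LinearMap.comp_add]
    rfl
  map_smul' γ x := rfl

theorem toRing_retract (i : ι) :
    (LinearMap.toSpanSingleton S.Γ (S.F.obj (S.Q i)) (S.gen i)) ∘ₗ S.toRing i = LinearMap.id :=
  LinearMap.ext fun x => S.smul_gen x

theorem projective_obj (i : ι) : Module.Projective S.Γ (S.F.obj (S.Q i)) :=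
  Module.Projective.of_split (S.toRing i) _ (S.toRing_retract i)

theorem finite_obj (i : ι) : Module.Finite S.Γ (S.F.obj (S.Q i)) :=
  Module.Finite.of_surjective
    (LinearMap.toSpanSingleton S.Γ (S.F.obj (S.Q i)) (S.gen i))
    fun x => ⟨S.toRing i x, S.smul_gen x⟩

variable {S}

theorem exists_hom_of_idem {N : Type*} [AddCommGroup N] [Module S.Γ N] {i : ι} {n : N}
    (hn : S.ofEnd (S.incl i ∘ₗ S.proj i) • n = n) :
    ∃ φ : S.F.obj (S.Q i) →ₗ[S.Γ] N, φ (S.gen i) = n :=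
  ⟨LinearMap.toSpanSingleton S.Γ N n ∘ₗ S.toRing i, hn⟩

/-- Yoneda's lemma for a summand of `Q`: a map is determined by the image of the generator, which is
a map `Q → X` that factors through the projection to `Q(i)`. -/
theorem exists_mapF_eq {i : ι} (φ : S.F.obj (S.Q i) →ₗ[S.Γ] S.F.obj X) :
    ∃ v : S.Q i →ₗ[Λ] X, S.mapF v = φ := by
  refine ⟨S.toLin (φ (S.gen i)) ∘ₗ S.incl i, hom_ext_gen ?_⟩
  have h := congrArg φ (S.idem_smul_gen i)
  rw [map_smul] at h
  exact toLin_injective (congrArg S.toLin h)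

theorem sum_idem_smul [Fintype ι] {N : Type*} [AddCommGroup N] [Module S.Γ N] (n : N) :
    ∑ i, S.ofEnd (S.incl i ∘ₗ S.proj i) • n = n := by
  rw [← Finset.sum_smul]
  have : ∑ i, S.ofEnd (S.incl i ∘ₗ S.proj i) = 1 := by
    have h : ∀ s : Finset ι, ∑ i ∈ s, S.ofEnd (S.incl i ∘ₗ S.proj i) =
        S.ofEnd (∑ i ∈ s, S.incl i ∘ₗ S.proj i) := fun s => by
      induction s using Finset.cons_induction with
      | empty => rfl
      | cons a s ha ih =>
        rw [Finset.sum_cons, Finset.sum_cons, ih]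
        rfl
    rw [h, sum_incl_comp_proj]
    rfl
  rw [this, one_smul]

/-- The idempotents of the `Q(i)` sum to `1`, so one of them acts nontrivially on `N`; the elements
it fixes are the images of the generator of `F(Q(i))`. -/
theorem exists_hom_ne_zero [Fintype ι] {N : Type*} [AddCommGroup N] [Module S.Γ N] [Nontrivial N] :
    ∃ (i : ι) (φ : S.F.obj (S.Q i) →ₗ[S.Γ] N), φ ≠ 0 := by
  obtain ⟨n, hn⟩ := exists_ne (0 : N)
  obtain ⟨i, hi⟩ : ∃ i, S.ofEnd (S.incl i ∘ₗ S.proj i) • n ≠ 0 := by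
    by_contra! h
    exact hn (by rw [← sum_idem_smul (S := S) n]; exact Finset.sum_eq_zero fun i _ => h i)
  obtain ⟨φ, hφ⟩ := exists_hom_of_idem (S := S) (i := i)
    (n := S.ofEnd (S.incl i ∘ₗ S.proj i) • n) (by
      rw [← mul_smul]
      congr 1
      change S.ofEnd ((S.incl i ∘ₗ S.proj i) ∘ₗ (S.incl i ∘ₗ S.proj i)) = _
      rw [LinearMap.comp_assoc, ← LinearMap.comp_assoc (S.proj i), proj_comp_incl,
        LinearMap.id_comp])
  exact ⟨i, φ, fun h => hi (by rw [← hφ, h]; rfl)⟩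

theorem isShortExact_mapF {f : X →ₗ[Λ] Y} {g : Y →ₗ[Λ] Z} (h : IsShortExact f g)
    (hE : ∀ i, Subsingleton (Ext (S.Q i) X 1)) : IsShortExact (S.mapF f) (S.mapF g) where
  injective x y hxy := by
    rw [← toLin_inj] at hxy ⊢
    exact LinearMap.ext fun q => h.injective (LinearMap.congr_fun hxy q)
  exact y := by
    constructor
    · intro hy
      rw [← toLin_inj] at hy
      obtain ⟨x, hx⟩ := h.exists_lift (S.toLin y) hy
      exact ⟨S.ofLin x, toLin_injective hx⟩
    · rintro ⟨x, rfl⟩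
      rw [← toLin_inj, toLin_mapF, toLin_mapF, ← LinearMap.comp_assoc, h.comp_eq_zero]
      rfl
  surjective z := by
    choose v hv using fun i => h.exists_lift_of_ext (hE i) (S.toLin z ∘ₗ S.incl i)
    obtain ⟨φ, hφ⟩ := exists_desc_sumQ v
    refine ⟨S.ofLin φ, toLin_injective (sumQ_hom_ext fun i => ?_)⟩
    rw [toLin_mapF, toLin_ofLin, LinearMap.comp_assoc, hφ, hv]

theorem hasFiltration_obj {C : ObjectProperty (ModuleCat.{u} Λ)}
    {C' : ObjectProperty (ModuleCat.{u} S.Γ)} {n : ℕ} (hX : HasFiltration C n X)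
    (hC : ∀ Y, C Y → ∃ i, Y = S.Ψ i) (hC' : ∀ Y, C Y → C' (S.F.obj Y)) :
    HasFiltration C' n (S.F.obj X) := by
  induction hX with
  | zero X h =>
    refine .zero _ ⟨fun x y => ?_⟩
    rw [← toLin_inj]
    exact LinearMap.ext fun _ => Subsingleton.elim _ _
  | succ N X Y f g h hN hY ih =>
    have hE : ∀ i, Subsingleton (Ext (S.Q i) N 1) := fun i => hN.ext_right fun Y hY => by
      obtain ⟨j, rfl⟩ := hC Y hY
      exact S.ext_Q i j
    exact .succ _ _ _ _ _ (isShortExact_mapF h hE) ih (hC' Y hY)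

theorem hasFiltration_obj_family {n : ℕ} (hX : HasFiltration (familyClass S.Ψ) n X) :
    HasFiltration (familyClass fun i => S.F.obj (S.Ψ i)) n (S.F.obj X) :=
  hasFiltration_obj hX (fun _ h => h) fun _ ⟨i, hi⟩ => ⟨i, hi ▸ rfl⟩

theorem hasFiltration_obj_lower {n : ℕ} {i : ι} (hX : HasFiltration (lowerClass S.Ψ i) n X) :
    HasFiltration (lowerClass (fun i => S.F.obj (S.Ψ i)) i) n (S.F.obj X) :=
  hasFiltration_obj hX (fun _ ⟨j, _, hj⟩ => ⟨j, hj⟩) fun _ ⟨j, hj, hY⟩ => ⟨j, hj, hY ▸ rfl⟩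

theorem ext_filtered {n : ℕ} (hX : HasFiltration (familyClass S.Ψ) n X) (i : ι) :
    Subsingleton (Ext (S.Q i) X 1) :=
  S.isBrickSystem.ext_cover_filtered hX i

variable (S)

theorem exists_cover (i : ι) : ∃ (Z : ModuleCat.{u} Λ) (n : ℕ) (α : Z →ₗ[Λ] S.Q i)
    (β : S.Q i →ₗ[Λ] S.Ψ i), IsShortExact α β ∧ HasFiltration (lowerClass S.Ψ i) n Z ∧
      IsShortExact (S.mapF α) (S.mapF β) := by
  obtain ⟨Z, n, α, β, h, hZ⟩ := S.isBrickSystem.cover i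
  exact ⟨Z, n, α, β, h, hZ, isShortExact_mapF h (ext_filtered hZ.family_of_lower)⟩

variable {S}

theorem hom_obj_eq_zero {i j : ι} (hij : i < j)
    (φ : S.F.obj (S.Q i) →ₗ[S.Γ] S.F.obj (S.Ψ j)) : φ = 0 := by
  obtain ⟨v, rfl⟩ := exists_mapF_eq φ
  rw [S.isBrickSystem.cover_hom_eq_zero hij v, mapF_zero]

/-- The map comes from a nonzero `Q(i) → Ψ(i)`, which is onto with filtered kernel; `F` is exact on
the resulting sequence. -/
theorem surjective_of_ne_zero {i : ι} {φ : S.F.obj (S.Q i) →ₗ[S.Γ] S.F.obj (S.Ψ i)}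
    (hφ : φ ≠ 0) : Function.Surjective φ := by
  obtain ⟨v, rfl⟩ := exists_mapF_eq φ
  obtain ⟨n, hn⟩ := S.isBrickSystem.cover_filtration i
  obtain ⟨hs, m, -, hm⟩ := S.isBrickSystem.ker_of_ne_zero hn (f := v) fun h => hφ (by rw [h, mapF_zero])
  exact (isShortExact_mapF (isShortExact_ker hs) (X := ModuleCat.of Λ (LinearMap.ker v))
    (ext_filtered hm.family_of_lower)).surjective

variable (S)

/-- The images under `F` form a system of the same kind, so all results on brick systems apply over
`Γ` too. A nonzero endomorphism of `F(Ψ(i))` is onto by the previous lemma, hence bijective by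
noetherianity. -/
theorem isBrickSystem_obj [IsNoetherianRing S.Γ] :
    IsBrickSystem (fun i => S.F.obj (S.Ψ i)) fun i => S.F.obj (S.Q i) where
  nontrivial i := by
    obtain ⟨Z, n, α, β, h, hZ, hF⟩ := S.exists_cover i
    have := S.isBrickSystem.nontrivial i
    obtain ⟨y, hy⟩ := exists_ne (0 : S.Ψ i)
    obtain ⟨x, rfl⟩ := h.surjective y
    refine ⟨⟨S.mapF β (S.gen i), 0, fun h0 => hy ?_⟩⟩
    have h1 : β ∘ₗ S.proj i = 0 := congrArg S.toLin h0
    have h2 := LinearMap.congr_fun h1 (S.incl i x)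
    rwa [LinearMap.comp_apply, show S.proj i (S.incl i x) = x from
      LinearMap.congr_fun (S.proj_comp_incl i) x] at h2
  bijective i f hf := by
    obtain ⟨Z, n, α, β, h, hZ, hF⟩ := S.exists_cover i
    have hfin := S.finite_obj i
    have : Module.Finite S.Γ (S.F.obj (S.Ψ i)) := Module.Finite.of_surjective _ hF.surjective
    have hne : f ∘ₗ S.mapF β ≠ 0 := fun h0 => hf <| LinearMap.ext fun y => by
      obtain ⟨x, rfl⟩ := hF.surjective y
      exact LinearMap.congr_fun h0 x
    have hs : Function.Surjective f := by
      have := surjective_of_ne_zero hne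
      rw [LinearMap.coe_comp] at this
      exact this.of_comp
    exact IsNoetherian.bijective_of_surjective_endomorphism f hs
  hom_eq_zero i j hij f := by
    obtain ⟨Z, n, α, β, h, hZ, hF⟩ := S.exists_cover i
    have h0 := hom_obj_eq_zero hij (f ∘ₗ S.mapF β)
    refine LinearMap.ext fun y => ?_
    obtain ⟨x, rfl⟩ := hF.surjective y
    exact LinearMap.congr_fun h0 x
  cover i := by
    obtain ⟨Z, n, α, β, h, hZ, hF⟩ := S.exists_cover i
    exact ⟨_, n, _, _, hF, hasFiltration_obj_lower hZ⟩
  ext_cover i j := ext_subsingleton_of_projective one_pos (S.projective_obj i)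

end ProperCostratifyingSystem

/-! ### Finiteness of `Γ` and the radical of `F(Q(i))` -/

namespace ProperCostratifyingSystem

variable {Λ : Type u} [Ring Λ] {ι : Type} [LinearOrder ι] (S : ProperCostratifyingSystem Λ ι)
  {X Y Z : ModuleCat.{u} Λ}

/-- As an `R`-module, `Γ` embeds in the noetherian module of `R`-endomorphisms of `Q`. -/
theorem finite_Γ (R : Type u) [CommRing R] [IsArtinianRing R] [Algebra R Λ] [Module.Finite R Λ]
    [Fintype ι] : Module.Finite R S.Γ := by
  have := S.finite_Q
  have hfin : Module.Finite Λ S.sumQ := inferInstanceAs (Module.Finite Λ (⨁ i, S.Q i))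
  let _ : Module R S.sumQ := Module.compHom S.sumQ (algebraMap R Λ)
  have hsm : ∀ (r : R) (x : S.sumQ), r • x = algebraMap R Λ r • x := fun _ _ => rfl
  have : IsScalarTower R Λ S.sumQ := ⟨fun r a x => by rw [hsm, Algebra.smul_def, mul_smul]⟩
  have : Module.Finite R S.sumQ := Module.Finite.trans Λ S.sumQ
  have : IsNoetherian R (S.sumQ →ₗ[R] S.sumQ) := inferInstance
  let E : S.Γ → (S.sumQ →ₗ[Λ] S.sumQ) := fun γ =>
    ModuleCat.Hom.hom (show S.sumQ ⟶ S.sumQ from γ.unop)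
  let φ : S.Γ →ₗ[R] (S.sumQ →ₗ[R] S.sumQ) :=
    { toFun := fun γ => (E γ).restrictScalars R
      map_add' := fun _ _ => rfl
      map_smul' := fun r γ => LinearMap.ext fun x => by
        rw [Algebra.smul_def]
        exact (E γ).map_smul (algebraMap R Λ r) x }
  refine Module.Finite.of_injective φ fun γ γ' h => ?_
  exact MulOpposite.unop_injective (ModuleCat.hom_ext (LinearMap.ext fun x =>
    LinearMap.congr_fun h x))

theorem isNoetherianRing_Γ (R : Type u) [CommRing R] [IsArtinianRing R] [Algebra R Λ]
    [Module.Finite R Λ] [Fintype ι] : IsNoetherianRing S.Γ := by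
  have := S.finite_Γ R
  exact isNoetherian_of_tower R inferInstance

theorem isArtinianRing_Γ (R : Type u) [CommRing R] [IsArtinianRing R] [Algebra R Λ]
    [Module.Finite R Λ] [Fintype ι] : IsArtinianRing S.Γ := by
  have := S.finite_Γ R
  exact isArtinian_of_tower R inferInstance

/-- The kernel of `F(Q(i)) → F(Ψ(i))` lies in the radical, and this map is universal among
those killing the radical maps from `F(Q(j))`, `j ≤ i`. -/
theorem exists_cover_jacobson [IsNoetherianRing S.Γ] (i : ι) (hQ : IsArtinian Λ (S.Q i))
    (hQ' : IsNoetherian Λ (S.Q i)) :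
    ∃ π : S.F.obj (S.Q i) →ₗ[S.Γ] S.F.obj (S.Ψ i), Function.Surjective π ∧
      LinearMap.ker π ≤ Module.jacobson S.Γ (S.F.obj (S.Q i)) ∧
      (traceSubmodule (A := S.Γ) (⨁ j : {j : ιᵒᵈ // OrderDual.toDual i ≤ j},
        S.F.obj (S.Q (OrderDual.ofDual j.1))) (Module.jacobson S.Γ (S.F.obj (S.Q i)))).map
          (Module.jacobson S.Γ (S.F.obj (S.Q i))).subtype = LinearMap.ker π := by
  obtain ⟨Z, n, α, β, h, hZ, hF⟩ := S.exists_cover i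
  have hB := S.isBrickSystem_obj
  have hnt := hB.nontrivial i
  have hproj := S.projective_obj i
  have hfin := S.finite_obj i
  have hne : LinearMap.ker (S.mapF β) ≠ ⊤ := fun h0 => by
    obtain ⟨y, hy⟩ := exists_ne (0 : S.F.obj (S.Ψ i))
    obtain ⟨x, rfl⟩ := hF.surjective y
    exact hy (LinearMap.mem_ker.1 (h0 ▸ Submodule.mem_top))
  have hjac : LinearMap.ker (S.mapF β) ≤ Module.jacobson S.Γ (S.F.obj (S.Q i)) := by
    refine le_sInf fun m hm => ?_
    by_contra hle
    have hsup : m ⊔ LinearMap.ker (S.mapF β) = ⊤ := hm.2 _ (left_lt_sup.2 hle)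
    have hs : Function.Surjective (m.mkQ ∘ₗ (LinearMap.ker (S.mapF β)).subtype) := by
      rw [← LinearMap.range_eq_top, LinearMap.range_comp, Submodule.range_subtype,
        Submodule.map_mkQ_eq_top, hsup]
    -- If a maximal submodule `m` misses part of the kernel, then the kernel maps onto the quotient
    -- by `m`. The quotient map therefore lifts to an endomorphism `F(v)` with values in the kernel.
    obtain ⟨u, hu⟩ := Module.projective_lifting_property _ m.mkQ hs
    obtain ⟨v, hv⟩ := exists_mapF_eq ((LinearMap.ker (S.mapF β)).subtype ∘ₗ u)
    have hmv : ∀ x, m.mkQ (S.mapF v x) = m.mkQ x := fun x => by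
      rw [hv]
      exact LinearMap.congr_fun hu x
    -- The quotient map is unchanged by `F(v)`, so a nilpotent `v` would make it zero; a bijective
    -- `v` would make the kernel everything.
    rcases (S.indecomposable_Q i).hasTrivialDecompositions.isNilpotent_or_bijective v with hn | hb
    · obtain ⟨k, hk⟩ := hn
      have hpow : ∀ (l : ℕ) x, m.mkQ (S.mapF (v ^ l) x) = m.mkQ x := fun l => by
        induction l with
        | zero => exact fun x => rfl
        | succ l ih =>
          intro x
          rw [pow_succ', ← ih x, ← hmv (S.mapF (v ^ l) x)]
          rfl
      refine hm.1 (eq_top_iff.2 fun x _ => ?_)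
      have h0 := hpow k x
      rw [hk] at h0
      exact (Submodule.Quotient.mk_eq_zero m).1 (h0.symm.trans (map_zero m.mkQ))
    · refine hne (eq_top_iff.2 fun x _ => ?_)
      let e := LinearEquiv.ofBijective v hb
      have hx : S.mapF v (S.ofLin (e.symm.toLinearMap ∘ₗ S.toLin x)) = x :=
        toLin_injective (LinearMap.ext fun q => e.apply_symm_apply _)
      rw [← hx, hv]
      exact (u _).2
  refine ⟨S.mapF β, hF.surjective, hjac, le_antisymm ?_ ?_⟩
  · rw [Submodule.map_le_iff_le_comap]
    refine iSup_le fun f => ?_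
    rintro _ ⟨d, rfl⟩
    refine LinearMap.congr_fun (f := S.mapF β ∘ₗ
      (Module.jacobson S.Γ (S.F.obj (S.Q i))).subtype ∘ₗ f) (g := 0) ?_ d
    refine DirectSum.linearMap_ext _ fun ⟨j, hj⟩ => ?_
    rcases (show OrderDual.ofDual j ≤ i from hj).lt_or_eq with hlt | rfl
    · exact hom_obj_eq_zero hlt _
    -- A nonzero map would be onto `F(Ψ(i))`. Then the radical and the kernel, itself inside the
    -- radical, would together fill `F(Q(i))`, against Nakayama's lemma.
    · by_contra h0
      have hs := surjective_of_ne_zero h0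
      have := hF.surjective.nontrivial
      refine (Module.jacobson_lt_top S.Γ (S.F.obj (S.Q (OrderDual.ofDual j)))).not_ge fun x _ => ?_
      obtain ⟨y, hy⟩ := hs (S.mapF β x)
      obtain ⟨w, hw⟩ : ∃ w : Module.jacobson S.Γ (S.F.obj (S.Q (OrderDual.ofDual j))),
        S.mapF β w.1 = S.mapF β x := ⟨_, hy⟩
      exact (Submodule.sub_mem_iff_left _ w.2).1 (hjac (LinearMap.sub_mem_ker_iff.2 hw.symm))
  · rintro x hx
    obtain ⟨z, rfl⟩ := (hF.exact x).1 hx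
    -- The kernel is the image of `F(Z)`, which is filtered with indices at most `i` and so
    -- generated by the `F(Q(j))`, `j ≤ i`.
    have hz : z ∈ ⨆ (j : {j // j ≤ i}) (f : S.F.obj (S.Q j) →ₗ[S.Γ] S.F.obj Z),
        LinearMap.range f := (hB.iSup_range_cover (hasFiltration_obj_lower hZ)) ▸ Submodule.mem_top
    refine Submodule.mem_comap.1 ((show _ ≤ Submodule.comap _ _ from
      iSup_le fun j => iSup_le fun f => ?_) hz)
    rintro _ ⟨y, rfl⟩
    let j' : {j : ιᵒᵈ // OrderDual.toDual i ≤ j} := ⟨OrderDual.toDual j.1, j.2⟩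
    let f' := ((S.mapF α ∘ₗ f).codRestrict (Module.jacobson S.Γ (S.F.obj (S.Q i))) fun y =>
      hjac ((hF.exact _).2 ⟨f y, rfl⟩)) ∘ₗ DirectSum.component S.Γ
        {j : ιᵒᵈ // OrderDual.toDual i ≤ j} (fun j => S.F.obj (S.Q (OrderDual.ofDual j.1))) j'
    refine ⟨f' (DirectSum.lof S.Γ _ _ j' y), Submodule.mem_iSup_of_mem f' ⟨_, rfl⟩, ?_⟩
    exact congrArg (fun w => S.mapF α (f w)) (DirectSum.component.lof_self (R := S.Γ)
      (M := fun j : {j : ιᵒᵈ // OrderDual.toDual i ≤ j} => S.F.obj (S.Q (OrderDual.ofDual j.1)))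
      j' y)

end ProperCostratifyingSystem

/-! ### Proper standard modules, and `Ext`-vanishing against images of injective modules -/

namespace ProperCostratifyingSystem

variable {Λ : Type u} [Ring Λ] {ι : Type} [LinearOrder ι] (S : ProperCostratifyingSystem Λ ι)
  {X Y Z I : ModuleCat.{u} Λ}

theorem properStandardΓ_equiv [IsNoetherianRing S.Γ] [IsArtinianRing Λ] (i : ι) :
    Nonempty (S.properStandardΓ (OrderDual.toDual i) ≃ₗ[S.Γ] S.F.obj (S.Ψ i)) := by
  have := S.finite_Q i
  obtain ⟨π, hs, -, hk⟩ := S.exists_cover_jacobson i inferInstance inferInstance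
  exact ⟨(Submodule.quotEquivOfEq _ _ hk).trans (LinearMap.quotKerEquivOfSurjective π hs)⟩

/-- The `Γ`-modules filtered by the modules `F(Ψ(i))`. -/
def filtΓ : ObjectProperty (ModuleCat.{u} S.Γ) := fun M =>
  ∃ n, HasFiltration (familyClass fun i => S.F.obj (S.Ψ i)) n M

theorem finite_obj_Ψ (i : ι) : Module.Finite S.Γ (S.F.obj (S.Ψ i)) := by
  obtain ⟨Z, n, α, β, h, hZ, hF⟩ := S.exists_cover i
  have := S.finite_obj i
  exact Module.Finite.of_surjective _ hF.surjective

variable {S}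

theorem filtΓ.finite {M : ModuleCat.{u} S.Γ} (hM : S.filtΓ M) : Module.Finite S.Γ M :=
  hM.choose_spec.finite fun _ ⟨i, hi⟩ => hi ▸ S.finite_obj_Ψ i

variable (S) in
theorem filtered_properStandardΓ_iff [IsNoetherianRing S.Γ] [IsArtinianRing Λ]
    (M : ModuleCat.{u} S.Γ) : Filtered (familyClass S.properStandardΓ) M ↔ S.filtΓ M := by
  constructor
  · intro hM
    obtain ⟨n, hn⟩ := hM.hasFiltration
    exact ⟨n, hn.mono fun _ ⟨i, hi⟩ => ⟨_, ⟨OrderDual.ofDual i, rfl⟩, hi ▸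
      S.properStandardΓ_equiv (OrderDual.ofDual i)⟩⟩
  · rintro ⟨n, hn⟩
    refine (hn.mono fun _ ⟨i, hi⟩ => ⟨_, ⟨OrderDual.toDual i, rfl⟩,
      hi ▸ (S.properStandardΓ_equiv i).map LinearEquiv.symm⟩ :
      HasFiltration (familyClass S.properStandardΓ) n M).filtered ?_
    rintro _ ⟨i, rfl⟩
    obtain ⟨e⟩ := S.properStandardΓ_equiv (OrderDual.ofDual i)
    have := S.finite_obj_Ψ (OrderDual.ofDual i)
    exact Module.Finite.equiv e.symm

/-- A filtered module is generated by images of the `Q(j)`, and `F(f) = 0` says that `f` kills all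
of these. -/
theorem mapF_injective [Fintype ι] {n : ℕ} (hX : HasFiltration (familyClass S.Ψ) n X)
    {f : X →ₗ[Λ] Y} (hf : S.mapF f = 0) : f = 0 := by
  rcases subsingleton_or_nontrivial X with h0 | h0
  · exact LinearMap.ext fun x => by rw [Subsingleton.elim x 0, map_zero, map_zero]
  · obtain ⟨k, hk, -⟩ := S.isBrickSystem.exists_ne_zero hX h0
    rw [← LinearMap.ker_eq_top, eq_top_iff, ← S.isBrickSystem.iSup_range_cover hk]
    refine iSup_le fun j => iSup_le fun q => ?_
    rintro _ ⟨x, rfl⟩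
    have h1 : f ∘ₗ q ∘ₗ S.proj j = 0 :=
      congrArg S.toLin (LinearMap.congr_fun hf (S.ofLin (q ∘ₗ S.proj j)))
    have h2 := LinearMap.congr_fun h1 (S.incl j x)
    rwa [LinearMap.comp_apply, LinearMap.comp_apply, show S.proj j (S.incl j x) = x from
      LinearMap.congr_fun (S.proj_comp_incl j) x] at h2

theorem exists_mapF_eq_of_injective [Fintype ι] {n : ℕ} (hX : HasFiltration (familyClass S.Ψ) n X)
    (hI : Module.Injective Λ I) (φ : S.F.obj X →ₗ[S.Γ] S.F.obj I) :
    ∃ f : X →ₗ[Λ] I, S.mapF f = φ := by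
  induction hX with
  | zero X h0 =>
    refine ⟨0, LinearMap.ext fun x => ?_⟩
    have : x = 0 := toLin_injective (LinearMap.ext fun _ => Subsingleton.elim _ _)
    rw [this, map_zero, map_zero]
  | succ N X Y a b h hN hY ih =>
    obtain ⟨j, rfl⟩ := hY
    have hab := isShortExact_mapF h (ext_filtered hN)
    obtain ⟨g, hg⟩ := ih (φ ∘ₗ S.mapF a)
    obtain ⟨g', hg'⟩ := hI.out a h.injective g
    have hga : g' ∘ₗ a = g := LinearMap.ext hg'
    -- After subtracting an extension of the map found on `N`, what remains factors through
    -- `F(Ψ(j))`. On `F(Q(j))` it comes from a map `v`, which kills `Z(j)` by faithfulness and so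
    -- descends to `Ψ(j)`.
    obtain ⟨ψ, hψ⟩ := hab.exists_desc (φ - S.mapF g') (by
      rw [LinearMap.sub_comp, ← mapF_comp, hga, hg, sub_self])
    obtain ⟨Z, n, α, β, hβ, hZ, hF⟩ := S.exists_cover j
    obtain ⟨v, hv⟩ := exists_mapF_eq (ψ ∘ₗ S.mapF β)
    obtain ⟨w, hw⟩ := hβ.exists_desc v (mapF_injective hZ.family_of_lower (by
      rw [mapF_comp, hv, LinearMap.comp_assoc, hF.comp_eq_zero, LinearMap.comp_zero]))
    have hwψ : S.mapF w = ψ := LinearMap.ext fun y => by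
      obtain ⟨x, rfl⟩ := hF.surjective y
      rw [← hw, mapF_comp] at hv
      exact LinearMap.congr_fun hv x
    refine ⟨g' + w ∘ₗ b, ?_⟩
    rw [← sub_add_cancel φ (S.mapF g'), ← hψ, ← hwψ, add_comm]
    rfl

/-- For `n = 1`, a map `F(Z(i)) → F(I)` comes from `Z(i) → I`, which extends to `Q(i)`, so it
extends to `F(Q(i))`. Higher degrees follow by dimension shifting, as `F(Z(i))` is filtered. -/
theorem ext_obj_injective [Fintype ι] {M : ModuleCat.{u} S.Γ} (hM : S.filtΓ M)
    (hI : Module.Injective Λ I) {n : ℕ} (hn : 0 < n) : Subsingleton (Ext M (S.F.obj I) n) := by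
  induction n, hn using Nat.le_induction generalizing M with
  | base =>
    obtain ⟨m, hm⟩ := hM
    refine hm.ext_left ?_
    rintro _ ⟨i, rfl⟩
    obtain ⟨Z, n, α, β, h, hZ, hF⟩ := S.exists_cover i
    refine hF.ext_one_of_extend (ext_subsingleton_of_projective one_pos (S.projective_obj i))
      fun φ => ?_
    obtain ⟨f, rfl⟩ := exists_mapF_eq_of_injective hZ.family_of_lower hI φ
    obtain ⟨g, hg⟩ := hI.out α h.injective f
    exact ⟨S.mapF g, by rw [← mapF_comp, show g ∘ₗ α = f from LinearMap.ext hg]⟩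
  | succ n hn ih =>
    obtain ⟨m, hm⟩ := hM
    refine hm.ext_left ?_
    rintro _ ⟨i, rfl⟩
    obtain ⟨Z, k, α, β, h, hZ, hF⟩ := S.exists_cover i
    exact hF.ext_third_left n (ih ⟨k, hasFiltration_obj_family hZ.family_of_lower⟩)
      (ext_subsingleton_of_projective n.succ_pos (S.projective_obj i))

end ProperCostratifyingSystem

/-! ### The cotilting pair over `Γ` and the uniform bound on syzygies -/

namespace ProperCostratifyingSystem

variable {Λ : Type u} [Ring Λ] {ι : Type} [LinearOrder ι] {S : ProperCostratifyingSystem Λ ι}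
  {X Y I : ModuleCat.{u} Λ} {T : ModuleCat.{u} S.Γ}

theorem retract_obj (h : IsRetractOf (A := Λ) X Y) :
    IsRetractOf (A := S.Γ) (S.F.obj X) (S.F.obj Y) := by
  obtain ⟨i, p, hip⟩ := h
  exact ⟨S.mapF i, S.mapF p, by rw [← mapF_comp, hip, mapF_id]⟩

theorem filtΓ.exists_syzygy {M : ModuleCat.{u} S.Γ} (hM : S.filtΓ M) :
    ∃ (K P : ModuleCat.{u} S.Γ) (f : K →ₗ[S.Γ] P) (g : P →ₗ[S.Γ] M),
      IsShortExact f g ∧ S.filtΓ K ∧ S.filtΓ P ∧ Module.Projective S.Γ P := by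
  obtain ⟨n, hn⟩ := hM
  induction hn with
  | zero M h0 =>
    exact ⟨M, M, LinearMap.id, 0, isShortExact_id_zero, ⟨0, .zero _ h0⟩, ⟨0, .zero _ h0⟩,
      Module.Projective.of_free⟩
  | succ N M Y a b h hN hY ih =>
    obtain ⟨j, rfl⟩ := hY
    obtain ⟨K, P, k, p, hp, ⟨l, hK⟩, ⟨l', hP⟩, hproj⟩ := ih
    obtain ⟨Z, m, α, β, hβ, hZ, hF⟩ := S.exists_cover j
    have hproj' := S.projective_obj j
    obtain ⟨m', hQ⟩ := S.isBrickSystem.cover_filtration j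
    obtain ⟨φ, hφ⟩ := Module.projective_lifting_property b (S.mapF β) h.surjective
    obtain ⟨π, hπ, c, d, hcd⟩ := h.horseshoe hp hF φ hφ
    exact ⟨ModuleCat.of S.Γ (LinearMap.ker π), ModuleCat.of S.Γ (P × S.F.obj (S.Q j)), _, π,
      isShortExact_ker hπ, ⟨_, hK.extension (hasFiltration_obj_family hZ.family_of_lower) hcd⟩,
      ⟨_, hP.prod (hasFiltration_obj_family hQ.family_of_lower)⟩,
      inferInstanceAs (Module.Projective S.Γ (P × S.F.obj (S.Q j)))⟩

theorem filtΓ.exists_cosyzygy [Fintype ι] (hinj : Module.Injective Λ I)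
    (hcos : ∀ i, ∃ (W C : ModuleCat.{u} Λ) (f : S.Ψ i →ₗ[Λ] W) (g : W →ₗ[Λ] C) (m : ℕ),
      IsShortExact f g ∧ IsRetractOf (A := Λ) W I ∧ HasFiltration (familyClass S.Ψ) m C)
    {M : ModuleCat.{u} S.Γ} (hM : S.filtΓ M) :
    ∃ (W C : ModuleCat.{u} S.Γ) (f : M →ₗ[S.Γ] W) (g : W →ₗ[S.Γ] C),
      IsShortExact f g ∧ PowerSummand (S.F.obj I) W ∧ S.filtΓ C := by
  obtain ⟨n, hn⟩ := hM
  induction hn with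
  | zero M h0 =>
    exact ⟨M, M, LinearMap.id, 0, isShortExact_id_zero, .zero h0, ⟨0, .zero _ h0⟩⟩
  | succ N M Y a b h hN hY ih =>
    obtain ⟨j, rfl⟩ := hY
    obtain ⟨W, C, i, c, hi, hW, ⟨l, hC⟩⟩ := ih
    obtain ⟨W', C', f, g, m, hfg, hW', hC'⟩ := hcos j
    have hF := isShortExact_mapF hfg fun i => S.ext_Q i j
    have hj : S.filtΓ (S.F.obj (S.Ψ j)) := ⟨1, .single ⟨j, rfl⟩⟩
    obtain ⟨φ, hφ⟩ := h.exists_extend (hW.ext (ext_obj_injective hj hinj one_pos)) i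
    obtain ⟨e, he, c, d, hcd⟩ := h.cohorseshoe hi hF φ hφ
    exact ⟨ModuleCat.of S.Γ (W × S.F.obj W'), ModuleCat.of S.Γ (_ ⧸ LinearMap.range e), e, _,
      isShortExact_range_mkQ he, hW.prod (.of_retract (retract_obj hW')),
      ⟨_, hC.extension (hasFiltration_obj_family hC') hcd⟩⟩

theorem isCotiltingPair [Fintype ι] [IsNoetherianRing S.Γ] {n : ℕ}
    (hI : HasFiltration (familyClass S.Ψ) n I) (hinj : Module.Injective Λ I)
    (hcos : ∀ i, ∃ (W C : ModuleCat.{u} Λ) (f : S.Ψ i →ₗ[Λ] W) (g : W →ₗ[Λ] C) (m : ℕ),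
      IsShortExact f g ∧ IsRetractOf (A := Λ) W I ∧ HasFiltration (familyClass S.Ψ) m C) :
    IsCotiltingPair S.filtΓ (S.F.obj I) where
  zero _ hM := ⟨0, .zero _ hM⟩
  extension _ _ _ _ _ h hX hZ := ⟨_, hX.choose_spec.extension hZ.choose_spec h⟩
  retract _ _ h hY := S.isBrickSystem_obj.filtration_of_retract hY.choose_spec h
  mem := ⟨n, hasFiltration_obj_family hI⟩
  ext _ hX _ hn := ext_obj_injective hX hinj hn
  cosyzygy _ hX := hX.exists_cosyzygy hinj hcos
  syzygy _ hX := hX.exists_syzygy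

/-- The kernel of `F(Q(j)) → F(Ψ(j))` is in the radical, so `φ` factors through `F(Ψ(j))`. A map to
the proper submodule `ker ψ` is zero: for `k < j` all maps to `F(Ψ(j))` are, and for `k = j` the
nonzero ones are onto. -/
theorem exists_simple_cover [IsNoetherianRing S.Γ] [IsArtinianRing Λ] {N : ModuleCat.{u} S.Γ}
    [IsSimpleModule S.Γ N] {j : ι} {φ : S.F.obj (S.Q j) →ₗ[S.Γ] N} (hφ : φ ≠ 0) :
    ∃ ψ : S.F.obj (S.Ψ j) →ₗ[S.Γ] N, Function.Surjective ψ ∧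
      ∀ k ≤ j, ∀ u : S.F.obj (S.Q k) →ₗ[S.Γ] LinearMap.ker ψ, u = 0 := by
  have := S.finite_Q j
  obtain ⟨π, hπ, hker, -⟩ := S.exists_cover_jacobson j inferInstance inferInstance
  have hs := LinearMap.surjective_of_ne_zero hφ
  have hle : LinearMap.ker π ≤ LinearMap.ker φ :=
    hker.trans (sInf_le (LinearMap.isCoatom_ker_of_surjective hs))
  obtain ⟨ψ, rfl⟩ := (isShortExact_ker hπ).exists_desc φ (LinearMap.ext fun x => hle x.2)
  have hψ : Function.Surjective ψ := by
    rw [LinearMap.coe_comp] at hs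
    exact hs.of_comp
  refine ⟨ψ, hψ, fun k hk u => ?_⟩
  by_contra hu
  have hne : (LinearMap.ker ψ).subtype ∘ₗ u ≠ 0 := fun h => hu (LinearMap.ext fun x =>
    Subtype.ext (LinearMap.congr_fun h x))
  rcases hk.lt_or_eq with hlt | rfl
  · exact hne (hom_obj_eq_zero hlt _)
  · refine hφ (LinearMap.ext fun x => ?_)
    obtain ⟨y, hy⟩ := surjective_of_ne_zero hne (π x)
    rw [LinearMap.comp_apply, ← hy]
    exact (u y).2

/-- Induction along a composition series. By projectivity of `F(Q(k))`, the second hypothesis on `L`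
says that only simple modules covered by some `F(Q(k))` with `s k` occur as factors. -/
theorem syzygyDim_of_isFiniteLength [Fintype ι] (hT : IsCotiltingPair S.filtΓ T) {s : ι → Prop}
    {m : ℕ} (hs : ∀ k, s k → ∀ N : ModuleCat.{u} S.Γ, IsSimpleModule S.Γ N →
      ∀ φ : S.F.obj (S.Q k) →ₗ[S.Γ] N, φ ≠ 0 → SyzygyDim S.filtΓ m N)
    {L : Type u} [AddCommGroup L] [Module S.Γ L] (hL : IsFiniteLength S.Γ L)
    (h0 : ∀ k, ¬ s k → ∀ u : S.F.obj (S.Q k) →ₗ[S.Γ] L, u = 0) :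
    SyzygyDim S.filtΓ m (ModuleCat.of S.Γ L) := by
  induction hL with
  | @of_subsingleton L _ _ hL => exact hT.syzygyDim_mono (.zero _ (hT.zero _ hL)) m.zero_le
  | @of_simple_quotient L _ _ N hN _ ih =>
    refine hT.syzygyDim_extension (X := ModuleCat.of S.Γ N) (Y := ModuleCat.of S.Γ L)
      (Z := ModuleCat.of S.Γ (L ⧸ N)) (isShortExact_mkQ N) (ih fun k hk u => ?_) ?_
    · exact LinearMap.ext fun x => Subtype.ext (LinearMap.congr_fun (h0 k hk (N.subtype ∘ₗ u)) x)
    · have := IsSimpleModule.nontrivial S.Γ (L ⧸ N)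
      obtain ⟨k, φ, hφ⟩ := exists_hom_ne_zero (S := S) (N := L ⧸ N)
      by_cases hk : s k
      · exact hs k hk (ModuleCat.of S.Γ (L ⧸ N)) hN φ hφ
      · have := S.projective_obj k
        obtain ⟨u, hu⟩ := Module.projective_lifting_property N.mkQ φ N.mkQ_surjective
        exact (hφ (by rw [← hu, h0 k hk u, LinearMap.comp_zero])).elim

/-- Downward induction on `j`: the simple module is `F(Ψ(j))` modulo a submodule whose composition
factors belong to indices `k > j`, so the bound is one more than the maximum over those `k`. -/
theorem exists_syzygyDim_simple [Fintype ι] [IsNoetherianRing S.Γ] [IsArtinianRing S.Γ]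
    [IsArtinianRing Λ] (hT : IsCotiltingPair S.filtΓ T) (j : ι) :
    ∃ n, ∀ N : ModuleCat.{u} S.Γ, IsSimpleModule S.Γ N →
      ∀ φ : S.F.obj (S.Q j) →ₗ[S.Γ] N, φ ≠ 0 → SyzygyDim S.filtΓ n N := by
  induction j using WellFoundedGT.induction with
  | _ j ih =>
    choose n hn using ih
    let m := Finset.univ.sup fun k : {k // j < k} => n k k.2
    refine ⟨m + 1, fun N hN φ hφ => ?_⟩
    obtain ⟨ψ, hψ, hker⟩ := exists_simple_cover hφ
    have := S.finite_obj_Ψ j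
    refine hT.syzygyDim_third (X := ModuleCat.of S.Γ (LinearMap.ker ψ)) (isShortExact_ker hψ) ?_
      ⟨1, .single ⟨j, rfl⟩⟩
    exact syzygyDim_of_isFiniteLength hT (s := fun k => j < k)
      (fun k hk N hN φ hφ => hT.syzygyDim_mono (hn k hk N hN φ hφ)
        (Finset.le_sup (f := fun k : {k // j < k} => n k k.2) (Finset.mem_univ ⟨k, hk⟩)))
      (isFiniteLength_iff_isNoetherian_isArtinian.2 ⟨inferInstance, inferInstance⟩)
      fun k hk => hker k (not_lt.1 hk)

theorem exists_syzygyDim [Fintype ι] [IsNoetherianRing S.Γ] [IsArtinianRing S.Γ]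
    [IsArtinianRing Λ] (hT : IsCotiltingPair S.filtΓ T) :
    ∃ n, ∀ M : ModuleCat.{u} S.Γ, Module.Finite S.Γ M → SyzygyDim S.filtΓ n M := by
  choose n hn using fun j => exists_syzygyDim_simple hT j
  refine ⟨Finset.univ.sup n, fun M hM => ?_⟩
  exact syzygyDim_of_isFiniteLength hT (s := fun _ => True)
    (fun k _ N hN φ hφ => hT.syzygyDim_mono (hn k N hN φ hφ) (Finset.le_sup (Finset.mem_univ k)))
    (isFiniteLength_iff_isNoetherian_isArtinian.2 ⟨inferInstance, inferInstance⟩)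
    fun k hk => (hk trivial).elim

end ProperCostratifyingSystem

theorem mainTheorem8 {R : Type u} [CommRing R] [IsArtinianRing R]
    {J : Type u} [AddCommGroup J] [Module R J]
    (hJ : IsInjectiveEnvelope R (R ⧸ Ring.jacobson R) J)
    {Λ : Type u} [Ring Λ] [Algebra R Λ] [Module.Finite R Λ]
    {ι : Type} [Fintype ι] [LinearOrder ι]
    (S : ProperCostratifyingSystem Λ ι)
    (hD : Filtered (familyClass S.Ψ) (dualRegular R J Λ))
    (hrk : Module.rank ℤ (GrothendieckGroup Λ) = (Fintype.card ι : Cardinal)) :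
    IsCotilting R J S.Γ (S.F.obj (dualRegular R J Λ)) ∧
    Filtered (familyClass S.properStandardΓ) = leftPerp (S.F.obj (dualRegular R J Λ)) ∧
    Filtered (familyClass S.properStandardΓ) ⊓
        rightPerpOne (Filtered (familyClass S.properStandardΓ)) =
      AddClosure (S.F.obj (dualRegular R J Λ)) := by
  have := S.finite_Γ R
  have := S.isNoetherianRing_Γ R
  have := S.isArtinianRing_Γ R
  have : IsArtinianRing Λ := isArtinian_of_tower R inferInstance
  obtain ⟨n, hn⟩ := hD.hasFiltration
  have hinj : Module.Injective Λ (dualRegular R J Λ) := regularDual_injective hJ.1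
  have hT : IsCotiltingPair S.filtΓ (S.F.obj (dualRegular R J Λ)) :=
    ProperCostratifyingSystem.isCotiltingPair hn hinj
      (S.isBrickSystem.exists_injective_cosyzygy S.finite_Ψ hn hinj hD.1 (fun M hM =>
        have := IsSimpleModule.nontrivial Λ M
        exists_ne_zero_regularDual hJ) hrk)
  obtain ⟨d, hd⟩ := ProperCostratifyingSystem.exists_syzygyDim hT
  have hfilt : Filtered (familyClass S.properStandardΓ) = S.filtΓ :=
    funext fun M => propext (S.filtered_properStandardΓ_iff M)
  -- Summands of powers of `T` are filtered, hence of finite length over the artinian ring `Γ`, so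
  -- that they decompose into indecomposable modules.
  have hadd : ∀ M, PowerSummand (S.F.obj (dualRegular R J Λ)) M →
      AddClosure (S.F.obj (dualRegular R J Λ)) M := fun M hM => by
    have := (hT.powerSummand_mem hM).finite
    exact hM.addClosure
  rw [hfilt]
  refine ⟨⟨hT.mem.finite, ⟨d, ?_⟩, fun m hm => hT.ext _ hT.mem m hm, ?_⟩, ?_, ?_⟩
  · exact hasInjectiveDimensionLE_of_ext fun M hM => hT.ext_eq_zero_of_syzygyDim (hd M hM)
      d.lt_succ_self
  -- The same envelope `J` defines the duality over `Γ`, where `D(Γ)` is injective and finitely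
  -- generated because `Γ` is an artin `R`-algebra.
  · exact (hT.resolution_of_injective (hd (dualRegular R J S.Γ) (finite_regularDual hJ))
      (regularDual_injective hJ.1)).mono hadd
  · ext M
    exact ⟨fun hM => ⟨hM.finite, hT.ext M hM⟩, fun hM => hT.mem_of_ext (hd M hM.1) hM.2⟩
  · ext M
    refine ⟨fun hM => hadd M (hT.powerSummand_of_ext hM.1 hM.2.2), fun hM => ?_⟩
    have hC := hT.powerSummand_mem hM.powerSummand
    exact ⟨hC, hC.finite, fun Y hY => hM.powerSummand.ext (hT.ext Y hY 1 one_pos)⟩
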